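/- Let $\lambda$ be a partition and let $x_1>x_2>\dots>x_n>x_{n+1}=0$ be such that $x_1,\dots,x_n$ are the distinct positive parts of $\lambda$; for $1\le p\le n$ let $y_p$ be the number of parts of $\lambda$ that are $\ge x_p$, and put $y_0=0$. Thus $\lambda=(x_1^{\,y_1-y_0},x_2^{\,y_2-y_1},\dots,x_n^{\,y_n-y_{n-1}})$, and the Ferrers board of $\lambda$, drawn in the plane, has the $n$ outside corners $(x_1,-y_1),\dots,(x_n,-y_n)$. More generally, points $(x_p,-y_p)$ $(1\le p\le n)$ with integers $x_1\ge\dots\ge x_n\ge 0$ and $0\le y_1\le\dots\le y_n$ encode the partition $(x_1^{\,y_1-y_0},\dots,x_n^{\,y_n-y_{n-1}})$, whose Ferrers board is the union of the rectangles with $y_p$ rows and $x_p$ columns. The following operations act on such lists of points (the shifted points remain the object on which later operations act, even if they are no longer geometric corners). * For $1\le i\le j\le n$, $\pi^i_j$ adds $1$ to each of $x_{i+1},\dots,x_j$ and $y_i,\dots,y_j$, and $\mu^i_j$ adds $-1$ to each of these numbers. * For $1\le i_1<\dots<i_m\le j_m<\dots<j_1\le n$, put $\pi^{i_1,\dots,i_m}_{j_1,\dots,j_m}=\pi^{i_1}_{j_1}\circ\dots\circ\pi^{i_m}_{j_m}$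 and $\mu^{i_1,\dots,i_m}_{j_1,\dots,j_m}=\mu^{i_1}_{j_1}\circ\dots\circ\mu^{i_m}_{j_m}$. * For $1\le k\le n$ and $l=y_k$, $\lambda\pm\omega_l$ is obtained by adding $\pm1$ to each of $x_1,\dots,x_k$, i.e. by adding or removing a column of length $l$. For a number $N$ of variables, let $s_\nu=s_\nu(z_1,\dots,z_N)=\sum_T\prod_{a=1}^N z_a^{m(T,a)}$ be the Schur function, where $T$ runs over the semistandard Young tableaux of shape $\nu$ with entries in $\{1,\dots,N\}$ and $m(T,a)$ is the number of entries $a$ in $T$. **Theorem.** Let $\lambda$ be a partition with $n$ outside corners, let $k$ be an integer with $1\le k\le n$, and set $l=y_k$. Then, for every $N$, $$s_\lambda s_\lambda=s_{\lambda+\omega_l}\,s_{\lambda-\omega_l}+\sum_{m\ge1}\ \sum_{\substack{1\le i_1<\dots<i_m\le k\\ k\le j_m<\dots<j_1\le n}}(-1)^{m-1}\,s_{\pi^{i_1,\dots,i_m}_{j_1,\dots,j_m}(\lambda)}\,s_{\mu^{i_1,\dots,i_m}_{j_1,\dots,j_m}(\lambda)}.$$ -/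

import Mathlib

/-- The semistandard Young tableaux of shape `mu` with entries in an alphabet of `N` letters,
here `0, …, N - 1` in place of `1, …, N`. -/
def BoundedTableau (N : ℕ) (mu : YoungDiagram) : Type :=
  {T : SemistandardYoungTableau mu // ∀ c ∈ mu.cells, T c.1 c.2 < N}

instance (N : ℕ) (mu : YoungDiagram) : Finite (BoundedTableau N mu) := by
  refine Finite.of_injective
    (fun (T : BoundedTableau N mu) (c : mu.cells) =>
      (⟨T.1 c.1.1 c.1.2, T.2 c.1 c.2⟩ : Fin N)) ?_
  intro S T h
  apply Subtype.ext
  apply SemistandardYoungTableau.ext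
  intro a b
  by_cases hc : (a, b) ∈ mu
  · have := congrFun h ⟨(a, b), (YoungDiagram.mem_cells _).2 hc⟩
    exact congrArg Fin.val this
  · rw [S.1.zeros hc, T.1.zeros hc]

noncomputable instance (N : ℕ) (mu : YoungDiagram) : Fintype (BoundedTableau N mu) :=
  Fintype.ofFinite _

/-- The Schur function `s_mu(z_1, …, z_N)`: the sum over the semistandard tableaux `T` of shape
`mu` with entries in an alphabet of `N` letters of the monomial in which the variable attached to
a letter `a` is raised to the number of occurrences of `a` in `T`. -/
noncomputable def schur (N : ℕ) (mu : YoungDiagram) : MvPolynomial (Fin N) ℤ :=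
  ∑ T : BoundedTableau N mu,
    ∏ a : Fin N, MvPolynomial.X a ^ (mu.cells.filter fun c => T.1 c.1 c.2 = (a : ℕ)).card

/-- A list of `n` points `(x_1, -y_1), …, (x_n, -y_n)` in the lattice. Only the values of the
sequences `x`, `y` at the indices `1, …, n` matter. -/
structure Corners where
  n : ℕ
  x : ℕ → ℤ
  y : ℕ → ℤ

namespace Corners

/-- The Ferrers board described by a list of points `(x_p, -y_p)`, `1 ≤ p ≤ n`: the union of the
rectangles with `y_p` rows and `x_p` columns. The cell in row `a` and column `b` (both counted
from `0`) belongs to it iff `a + 1 ≤ y_p` and `b + 1 ≤ x_p` for some `p`. If `x` is weakly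
decreasing and `y` is weakly increasing (and both are nonnegative), it is the board of the
partition `(x_1 ^ (y_1 - y_0), …, x_n ^ (y_n - y_(n-1)))`, where `y_0 = 0`. -/
def board (c : Corners) : YoungDiagram where
  cells := (Finset.Icc 1 c.n).biUnion fun p =>
    Finset.range (c.y p).toNat ×ˢ Finset.range (c.x p).toNat
  isLowerSet := by
    rintro ⟨a, b⟩ ⟨a', b'⟩ h hm
    have h1 : a' ≤ a := h.1
    have h2 : b' ≤ b := h.2
    simp only [Finset.coe_biUnion, Set.mem_iUnion, Finset.mem_coe, Finset.mem_product,
      Finset.mem_range] at hm ⊢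
    obtain ⟨p, hp, ha, hb⟩ := hm
    exact ⟨p, hp, lt_of_le_of_lt h1 ha, lt_of_le_of_lt h2 hb⟩

/-- Add `d` to each of `x_(i+1), …, x_j` and to each of `y_i, …, y_j`. For `d = 1` this adds a
border strip (the operation `π^i_j`), for `d = -1` it removes one (the operation `μ^i_j`). -/
def strip (d : ℤ) (i j : ℕ) (c : Corners) : Corners where
  n := c.n
  x := fun p => if i + 1 ≤ p ∧ p ≤ j then c.x p + d else c.x p
  y := fun p => if i ≤ p ∧ p ≤ j then c.y p + d else c.y p

/-- The operation `π^i_j`. -/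
def piOp (i j : ℕ) : Corners → Corners := strip 1 i j

/-- The operation `μ^i_j`. -/
def muOp (i j : ℕ) : Corners → Corners := strip (-1) i j

/-- `π^{i_1,…,i_m}_{j_1,…,j_m} = π^{i_1}_{j_1} ∘ ⋯ ∘ π^{i_m}_{j_m}`. -/
def piNested {m : ℕ} (i j : Fin m → ℕ) : Corners → Corners :=
  (List.ofFn fun r => piOp (i r) (j r)).foldr (fun f g => f ∘ g) id

/-- `μ^{i_1,…,i_m}_{j_1,…,j_m} = μ^{i_1}_{j_1} ∘ ⋯ ∘ μ^{i_m}_{j_m}`. -/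
def muNested {m : ℕ} (i j : Fin m → ℕ) : Corners → Corners :=
  (List.ofFn fun r => muOp (i r) (j r)).foldr (fun f g => f ∘ g) id

/-- Add `d` to each of `x_1, …, x_k`. For `d = 1` this adds a column of length `l = y_k`
(the operation `λ + ω_l`), for `d = -1` it removes one (the operation `λ - ω_l`). -/
def shiftColumn (d : ℤ) (k : ℕ) (c : Corners) : Corners where
  n := c.n
  x := fun p => if 1 ≤ p ∧ p ≤ k then c.x p + d else c.x p
  y := c.y

/-- `λ + ω_l`, where `l = y_k`. -/
def addOmega (k : ℕ) : Corners → Corners := shiftColumn 1 k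

/-- `λ - ω_l`, where `l = y_k`. -/
def subOmega (k : ℕ) : Corners → Corners := shiftColumn (-1) k

end Corners

/-- The distinct (positive) parts of a partition, in decreasing order. -/
def distinctParts (lam : YoungDiagram) : List ℕ :=
  lam.rowLens.toFinset.sort (· ≥ ·)

/-- The outside corners `(x_p, -y_p)`, `1 ≤ p ≤ n`, of a partition: `x_1 > ⋯ > x_n` are its
distinct parts, and `y_p` is the number of its parts that are `≥ x_p`. -/
def outsideCorners (lam : YoungDiagram) : Corners where
  n := (distinctParts lam).length
  x := fun p => ((distinctParts lam).getD (p - 1) 0 : ℕ)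
  y := fun p =>
    ((lam.rowLens.filter fun part => (distinctParts lam).getD (p - 1) 0 ≤ part).length : ℕ)

/-- The pairs of `m`-tuples `1 ≤ i_1 < ⋯ < i_m ≤ k` and `k ≤ j_m < ⋯ < j_1 ≤ n`. There are none
if `m > n`. -/
def nestedIndices (n k m : ℕ) : Finset ((Fin m → ℕ) × (Fin m → ℕ)) :=
  (Fintype.piFinset (fun _ : Fin m => Finset.Icc 1 k) ×ˢ
    Fintype.piFinset (fun _ : Fin m => Finset.Icc k n)).filter fun q =>
      (∀ r s : Fin m, r < s → q.1 r < q.1 s) ∧ (∀ r s : Fin m, r < s → q.2 s < q.2 r)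

/-! The identity is one Plücker relation between alternants, the determinants with entries `z i ^ f
j`. Take `M + 1` variables with `M` large, and let `e t = λ_t + M - t` be the exponents of `λ` in
the bialternant formula. Let `I` be the set of the first `l = y_k` rows. The exponents of `λ + ω_l`
are `e t + 1` on `I` and `e t` off `I`. Those of `λ - ω_l`, all raised by one (which costs a factor
`∏ z i`), are `e t` on `I` and `e t + 1` off `I`. Exchange the columns `I` of the first determinant
with the columns `J` of the second, and sum over all `J` with `|J| = |I|`
(`Matrix.det_mul_det_exchange`). The choice `J = I` gives `s_λ s_λ`.

If some `t ∈ I \ J` is not the last row of a block, then `e t = e (t + 1) + 1` with `t + 1 ∈ I`, and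
the second determinant has two equal columns. If some `t ∈ J \ I` is not the first row of a block
(the first empty row counts as one), the first determinant has two equal columns. So the surviving
`J` arise from `I` by trading the last rows of blocks `i_1 < ⋯ < i_m ≤ k` for the first rows after
blocks `j_1 > ⋯ > j_m ≥ k`.

For such `J`, with last rows `p_r` and first rows `q_r`, the first determinant has `e p_r` replaced
by `e q_r + 1`, and the second, lowered by one, has `e q_r` replaced by `e p_r - 1`. Up to order
these are the exponents of `μ(λ)` and `π(λ)` (`exists_perm_exps_stripNested`). The two reorderings
have equal signs, and the exchange itself contributes `(-1)^m`. Hence `s_{λ+ω} s_{λ-ω} = ∑_{m ≥ 0}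
(-1)^m ∑ s_π s_μ`, and isolating `m = 0` gives the theorem.

The bialternant formula is proved by induction on the number of variables: the branching rule for
tableaux matches a column reduction of the alternant. The common factors are cancelled for
independent variables, and the superfluous variables are then set to zero. -/

/-! ### The Plücker relation for determinants. -/

open Matrix in
/-- The Leibniz terms of a determinant, grouped by the preimage of a fixed set of rows. -/
theorem Matrix.det_eq_sum_det_ite {n R : Type*} [Fintype n] [DecidableEq n] [CommRing R]
    (B : Matrix n n R) (I : Finset n) :
    B.det = ∑ J ∈ Finset.powersetCard I.card Finset.univ,
      (Matrix.of fun i j => if (i ∈ I ↔ j ∈ J) then B i j else 0).det := by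
  simp only [Matrix.det_apply]
  rw [Finset.sum_comm]
  refine Finset.sum_congr rfl fun σ _ => ?_
  -- The term of `σ` survives only for `J = σ⁻¹(I)`; any other `J` produces a zero factor.
  rw [Finset.sum_eq_single (Finset.univ.filter fun j => σ j ∈ I)]
  · simp
  · intro J _ hJ
    have : ∃ j, ¬ (σ j ∈ I ↔ j ∈ J) := by
      by_contra! h
      exact hJ (by ext j; simp [h j])
    obtain ⟨j, hj⟩ := this
    rw [Finset.prod_eq_zero (Finset.mem_univ j), smul_zero]
    simp [hj]
  · intro h
    refine absurd ?_ h
    rw [Finset.mem_powersetCard]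
    refine ⟨Finset.subset_univ _, ?_⟩
    refine Finset.card_bij (fun j _ => σ j) (by simp) (by simp) fun i hi => ⟨σ.symm i, by simp [hi]⟩

/-- After the columns are permuted by `σ⁻¹` the matrix is block diagonal. Each block is written as a
full-size determinant padded with identity columns, so that it can later be multiplied by `A`. -/
theorem Matrix.det_ite_iff_eq_mul {n R : Type*} [Fintype n] [DecidableEq n] [CommRing R]
    (B : Matrix n n R) (p q : n → Prop) [DecidablePred p] [DecidablePred q]
    (σ : Equiv.Perm n) (hσ : ∀ t, p (σ t) ↔ q t) :
    (Matrix.of fun i j => if (p i ↔ q j) then B i j else 0).det =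
      (Matrix.of fun i j => if p j then B i (σ.symm j) else (1 : Matrix n n R) i j).det *
      (Matrix.of fun i j => if q j then (1 : Matrix n n R) i (σ j) else B i j).det := by
  have hs : ∀ j, q (σ.symm j) ↔ p j := fun j => by rw [← hσ]; simp
  have hsq : ((Equiv.Perm.sign σ.symm : ℤˣ) : R) * ((Equiv.Perm.sign σ.symm : ℤˣ) : R) = 1 := by
    rw [← Int.cast_mul, ← Units.val_mul, Int.units_mul_self]; simp
  have h1 := Matrix.det_permute' σ.symm
    (Matrix.of fun i j => if (p i ↔ q j) then B i j else 0)
  have h2 := Matrix.det_permute' σ.symm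
    (Matrix.of fun i j => if q j then (1 : Matrix n n R) i (σ j) else B i j)
  rw [Matrix.twoBlockTriangular_det _ (fun i => p i) (by
    intro i hi j hj; simp [hs, hi, hj])] at h1
  rw [Matrix.twoBlockTriangular_det _ (fun i => p i) (by
    intro i hi j hj
    have : i ≠ j := by rintro rfl; exact hi hj
    simp [hs, hj, this])] at h2
  rw [Matrix.twoBlockTriangular_det'
    (Matrix.of fun i j => if p j then B i (σ.symm j) else (1 : Matrix n n R) i j)
    (fun i => p i) (by
      intro i hi j hj
      have : i ≠ j := by rintro rfl; exact hj hi
      simp [hj, this])]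
  set D := (Matrix.of fun i j => if (p i ↔ q j) then B i j else 0).det
  set E := (Matrix.of fun i j => if q j then (1 : Matrix n n R) i (σ j) else B i j).det
  set s := ((Equiv.Perm.sign σ.symm : ℤˣ) : R)
  have e1 : (Matrix.toSquareBlockProp ((Matrix.of fun i j =>
      if q j then (1 : Matrix n n R) i (σ j) else B i j).submatrix id σ.symm)
        (fun i => p i)) = 1 := by
    ext i j
    simp [Matrix.toSquareBlockProp_def, hs, j.2, Matrix.one_apply, Subtype.ext_iff]
  have e2 : (Matrix.toSquareBlockProp (Matrix.of fun i j =>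
      if p j then B i (σ.symm j) else (1 : Matrix n n R) i j) (fun i => ¬ p i)) = 1 := by
    ext i j
    simp [Matrix.toSquareBlockProp_def, j.2, Matrix.one_apply, Subtype.ext_iff]
  have e3 : (Matrix.toSquareBlockProp (Matrix.of fun i j =>
      if p j then B i (σ.symm j) else (1 : Matrix n n R) i j) (fun i => p i)) =
      (Matrix.toSquareBlockProp ((Matrix.of fun i j =>
        if (p i ↔ q j) then B i j else 0).submatrix id σ.symm) (fun i => p i)) := by
    ext i j
    simp [Matrix.toSquareBlockProp_def, hs, i.2, j.2]
  have e4 : (Matrix.toSquareBlockProp ((Matrix.of fun i j =>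
      if q j then (1 : Matrix n n R) i (σ j) else B i j).submatrix id σ.symm)
        (fun i => ¬ p i)) =
      (Matrix.toSquareBlockProp ((Matrix.of fun i j =>
        if (p i ↔ q j) then B i j else 0).submatrix id σ.symm) (fun i => ¬ p i)) := by
    ext i j
    simp [Matrix.toSquareBlockProp_def, hs, i.2, j.2]
  rw [e1, e4, Matrix.det_one, one_mul] at h2
  rw [e2, Matrix.det_one, mul_one, e3]
  rw [h2] at h1
  linear_combination (-s) * h1 + (E * Matrix.det (Matrix.toSquareBlockProp ((Matrix.of fun i j =>
        if (p i ↔ q j) then B i j else 0).submatrix id σ.symm) (fun i => p i)) - D) * hsq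

/-- Apply the expansion along the rows `I` to `adj(A) * B`. Left multiplication by `A` turns
identity columns into columns of `A` and the other columns into `det A` times columns of `B`; since
`|J| = |I|`, every term carries the same power of `det A`. -/
theorem Matrix.det_mul_det_exchange_of_ne_zero {n R : Type*} [Fintype n] [DecidableEq n]
    [CommRing R] [IsDomain R] (A B : Matrix n n R) (hA : A.det ≠ 0) (I : Finset n)
    (σ : Finset n → Equiv.Perm n)
    (hσ : ∀ J, J.card = I.card → ∀ t, σ J t ∈ I ↔ t ∈ J) :
    A.det * B.det = ∑ J ∈ Finset.powersetCard I.card Finset.univ,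
      (Matrix.of fun i j => if j ∈ I then B i ((σ J).symm j) else A i j).det *
      (Matrix.of fun i j => if j ∈ J then A i (σ J j) else B i j).det := by
  set M : Matrix n n R := A.adjugate * B with hM
  have hAM : A * M = A.det • B := by
    rw [hM, ← Matrix.mul_assoc, Matrix.mul_adjugate, Matrix.smul_mul, Matrix.one_mul]
  have hAM' : ∀ i j, ∑ x, A i x * M x j = A.det * B i j := fun i j => by
    have := congrFun (congrFun hAM i) j
    simpa [Matrix.mul_apply] using this
  have h := Matrix.det_eq_sum_det_ite M I
  have hdet : A.det * M.det = A.det ^ Fintype.card n * B.det := by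
    rw [← Matrix.det_mul, hAM, Matrix.det_smul]
  apply mul_left_cancel₀ (pow_ne_zero (Fintype.card n) hA)
  have key : ∀ J ∈ Finset.powersetCard I.card (Finset.univ : Finset n),
      A.det * A.det * (Matrix.of fun i j => if (i ∈ I ↔ j ∈ J) then M i j else 0).det =
      A.det ^ Fintype.card n *
        ((Matrix.of fun i j => if j ∈ I then B i ((σ J).symm j) else A i j).det *
        (Matrix.of fun i j => if j ∈ J then A i (σ J j) else B i j).det) := by
    intro J hJ
    have hc := (Finset.mem_powersetCard.1 hJ).2
    rw [Matrix.det_ite_iff_eq_mul M (· ∈ I) (· ∈ J) (σ J) (hσ J hc)]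
    have e1 : A.det * (Matrix.of fun i j =>
        if j ∈ I then M i ((σ J).symm j) else (1 : Matrix n n R) i j).det =
        (∏ j, if j ∈ I then A.det else 1) *
        (Matrix.of fun i j => if j ∈ I then B i ((σ J).symm j) else A i j).det := by
      rw [← Matrix.det_mul, ← Matrix.det_mul_row]
      congr 1
      ext i j
      by_cases hj : j ∈ I
      · simp [Matrix.mul_apply, hj, hAM']
      · simp [Matrix.mul_apply, hj, Matrix.one_apply]
    have e2 : A.det * (Matrix.of fun i j =>
        if j ∈ J then (1 : Matrix n n R) i (σ J j) else M i j).det =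
        (∏ j, if j ∈ J then 1 else A.det) *
        (Matrix.of fun i j => if j ∈ J then A i (σ J j) else B i j).det := by
      rw [← Matrix.det_mul, ← Matrix.det_mul_row]
      congr 1
      ext i j
      by_cases hj : j ∈ J
      · simp [Matrix.mul_apply, hj, Matrix.one_apply]
      · simp [Matrix.mul_apply, hj, hAM']
    have e3 : (∏ j, if j ∈ I then A.det else 1) * (∏ j, if j ∈ J then 1 else A.det) =
        A.det ^ Fintype.card n := by
      have h0 : ∀ K : Finset n, (∏ j, if j ∈ K then A.det else 1) = A.det ^ K.card := fun K => by
        simp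
      rw [h0, ← hc, ← h0, ← Finset.prod_mul_distrib]
      rw [Finset.prod_congr rfl (g := fun _ => A.det)]
      · simp
      · intro j _; split_ifs <;> simp
    rw [mul_mul_mul_comm, e1, e2, ← e3]
    ring
  rw [Finset.mul_sum, ← Finset.sum_congr rfl key, ← Finset.mul_sum, ← h]
  linear_combination (-A.det) * hdet

/-- Plücker relation: the product of two determinants is the sum of the products obtained by
exchanging the columns of the first at a fixed set `I` of positions with the columns of the second
at all sets `J` of positions of the same size. -/
theorem Matrix.det_mul_det_exchange {n R : Type*} [Fintype n] [DecidableEq n]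
    [CommRing R] [IsDomain R] (A B : Matrix n n R) (I : Finset n)
    (σ : Finset n → Equiv.Perm n)
    (hσ : ∀ J, J.card = I.card → ∀ t, σ J t ∈ I ↔ t ∈ J) :
    A.det * B.det = ∑ J ∈ Finset.powersetCard I.card Finset.univ,
      (Matrix.of fun i j => if j ∈ I then B i ((σ J).symm j) else A i j).det *
      (Matrix.of fun i j => if j ∈ J then A i (σ J j) else B i j).det := by
  -- The generic matrix has nonzero determinant; evaluating its entries at those of `A` covers
  -- singular `A`.
  have h := Matrix.det_mul_det_exchange_of_ne_zero (Matrix.mvPolynomialX n n R)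
    (B.map MvPolynomial.C) (Matrix.det_mvPolynomialX_ne_zero n R) I σ hσ
  apply_fun MvPolynomial.eval (fun p : n × n => A p.1 p.2) at h
  simp only [map_mul, map_sum, RingHom.map_det, RingHom.mapMatrix_apply] at h
  convert h using 4 <;> ext i j <;>
    simp only [Matrix.map_apply, Matrix.of_apply] <;> (try split_ifs) <;> simp

/-! ### Schur functions as tableau sums over arbitrary rings. -/

/-- The sum over the semistandard tableaux of shape `mu` with entries `< N` of the products of the
values of `z` at the entries. -/
noncomputable def tableauSum {R : Type*} [CommRing R] (N : ℕ) (mu : YoungDiagram) (z : ℕ → R) : R :=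
  ∑ T : BoundedTableau N mu, ∏ c ∈ mu.cells, z (T.1 c.1 c.2)

theorem schur_eq_tableauSum (N : ℕ) (mu : YoungDiagram) :
    schur N mu = tableauSum N mu fun a => if h : a < N then MvPolynomial.X ⟨a, h⟩ else 0 := by
  refine Finset.sum_congr rfl fun T _ => ?_
  rw [← Finset.prod_fiberwise_of_maps_to (s := mu.cells) (t := Finset.range N)
    (g := fun c => T.1 c.1 c.2) (fun c hc => Finset.mem_range.2 (T.2 c hc)), Finset.prod_range]
  refine Finset.prod_congr rfl fun a _ => ?_
  rw [Finset.prod_congr rfl (g := fun _ => (MvPolynomial.X a : MvPolynomial (Fin N) ℤ)),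
    Finset.prod_const]
  intro c hc
  simp [(Finset.mem_filter.1 hc).2]

theorem map_tableauSum {R S : Type*} [CommRing R] [CommRing S] (f : R →+* S) (N : ℕ)
    (mu : YoungDiagram) (z : ℕ → R) :
    f (tableauSum N mu z) = tableauSum N mu fun a => f (z a) := by
  simp [tableauSum]

/-- A tableau that uses a letter `≥ N` has a zero factor in its monomial. -/
theorem tableauSum_eq_of_le {R : Type*} [CommRing R] {N M : ℕ} (hNM : N ≤ M) (mu : YoungDiagram)
    (z : ℕ → R) (hz : ∀ a, N ≤ a → z a = 0) : tableauSum M mu z = tableauSum N mu z := by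
  symm
  refine Finset.sum_of_injOn (fun T => ⟨T.1, fun c hc => (T.2 c hc).trans_le hNM⟩) ?_ ?_ ?_ ?_
  · intro S _ T _ h
    exact Subtype.ext (congrArg (fun T : BoundedTableau M mu => T.1) h)
  · exact fun _ _ => Finset.mem_coe.2 (Finset.mem_univ _)
  · intro T _ hT
    by_cases h : ∀ c ∈ mu.cells, T.1 c.1 c.2 < N
    · exact absurd ⟨⟨T.1, h⟩, Finset.mem_coe.2 (Finset.mem_univ _), rfl⟩ hT
    · push Not at h
      obtain ⟨c, hc, h⟩ := h
      exact Finset.prod_eq_zero hc (hz _ h)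
  · intro T _
    rfl

/-! ### Interlacing sequences and the branching rule. -/

/-- The diagram whose `i`-th row has length `f i`, for an antitone `f`. -/
def diagramOf {N : ℕ} (f : Fin N → ℕ) : YoungDiagram where
  cells := (Finset.univ : Finset (Fin N)).biUnion fun i =>
    -- Truncating to the running minimum makes this a lower set for every `f`; for antitone `f`
    -- nothing is lost.
    ((Finset.range (f i)).filter fun b => ∀ i', i' ≤ i → b < f i').image fun b => ((i : ℕ), b)
  isLowerSet := by
    rintro ⟨a, b⟩ ⟨a', b'⟩ h hm
    have h1 : a' ≤ a := h.1
    have h2 : b' ≤ b := h.2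
    simp only [Finset.coe_biUnion, Set.mem_iUnion, Finset.mem_coe, Finset.mem_image,
      Finset.mem_filter, Finset.mem_range, Prod.mk.injEq] at hm ⊢
    obtain ⟨i, _, c, ⟨hc, hi⟩, rfl, rfl⟩ := hm
    have := i.2
    refine ⟨⟨a', by omega⟩, Finset.mem_univ _, b', ⟨?_, ?_⟩, rfl, rfl⟩
    · exact h2.trans_lt (hi _ h1)
    · exact fun i' hi' => h2.trans_lt (hi _ (le_trans (show i' ≤ _ from hi') h1))

theorem mem_diagramOf {N : ℕ} {f : Fin N → ℕ} (hf : Antitone f) {a b : ℕ} :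
    (a, b) ∈ diagramOf f ↔ ∃ h : a < N, b < f ⟨a, h⟩ := by
  rw [← YoungDiagram.mem_cells]
  simp only [diagramOf, Finset.mem_biUnion, Finset.mem_univ, true_and, Finset.mem_image,
    Finset.mem_filter, Finset.mem_range, Prod.mk.injEq]
  constructor
  · rintro ⟨i, c, ⟨h, _⟩, rfl, rfl⟩
    exact ⟨i.2, h⟩
  · rintro ⟨h, hb⟩
    exact ⟨⟨a, h⟩, b, ⟨hb, fun i' hi' => hb.trans_le (hf hi')⟩, rfl, rfl⟩

theorem rowLen_diagramOf {N : ℕ} {f : Fin N → ℕ} (hf : Antitone f) (i : Fin N) :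
    (diagramOf f).rowLen i = f i := by
  refine eq_of_forall_lt_iff fun b => ?_
  rw [← YoungDiagram.mem_iff_lt_rowLen, mem_diagramOf hf]
  simp

theorem YoungDiagram.prod_cells {M : Type*} [CommMonoid M] (mu : YoungDiagram) {K : ℕ}
    (hK : ∀ c ∈ mu.cells, c.1 < K) (g : ℕ × ℕ → M) :
    ∏ c ∈ mu.cells, g c =
      ∏ i ∈ Finset.range K, ∏ j ∈ Finset.range (mu.rowLen i), g (i, j) := by
  refine Finset.prod_finset_product _ _ _ fun c => ?_
  rw [Finset.mem_range, Finset.mem_range, ← YoungDiagram.mem_iff_lt_rowLen]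
  exact ⟨fun h => ⟨hK c h, (YoungDiagram.mem_cells c).1 h⟩, fun h => (YoungDiagram.mem_cells c).2 h.2⟩

theorem SemistandardYoungTableau.le_apply {mu : YoungDiagram} (T : SemistandardYoungTableau mu)
    {i j : ℕ} (h : (i, j) ∈ mu) : i ≤ T i j := by
  induction i with
  | zero => exact Nat.zero_le _
  | succ i ih =>
    have h1 := ih (mu.up_left_mem (Nat.le_succ i) le_rfl h)
    have h2 := T.col_strict (Nat.lt_add_one i) h
    omega

/-- The entries of a tableau that are less than `N` form in the `i`-th row an initial segment; this
is its length. -/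
noncomputable def initialLen {mu : YoungDiagram} (T : SemistandardYoungTableau mu) (N i : ℕ) : ℕ :=
  open Classical in
  Nat.find (p := fun b => ¬ ((i, b) ∈ mu ∧ T i b < N))
    (let ⟨b, hb⟩ := YoungDiagram.exists_notMem_row mu i; ⟨b, fun h => hb h.1⟩)

theorem lt_initialLen {mu : YoungDiagram} (T : SemistandardYoungTableau mu) {N i b : ℕ} :
    b < initialLen T N i ↔ (i, b) ∈ mu ∧ T i b < N := by
  classical
  rw [initialLen, Nat.lt_find_iff]
  simp only [not_not]
  exact ⟨fun h => h b le_rfl, fun h c hc => ⟨mu.up_left_mem le_rfl hc h.1,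
    (T.row_weak_of_le hc h.1).trans_lt h.2⟩⟩

/-- The sequences that interlace with `r`: `r (j + 1) ≤ f j ≤ r j` for `j < N`. -/
def interlacing (N : ℕ) (r : ℕ → ℕ) : Finset (Fin N → ℕ) :=
  Fintype.piFinset fun j : Fin N => Finset.Icc (r (j + 1)) (r j)

theorem mem_interlacing {N : ℕ} {r : ℕ → ℕ} {f : Fin N → ℕ} :
    f ∈ interlacing N r ↔ ∀ j : Fin N, r (j + 1) ≤ f j ∧ f j ≤ r j := by
  simp [interlacing]

theorem antitone_of_mem_interlacing {N : ℕ} {r : ℕ → ℕ} (hr : Antitone r) {f : Fin N → ℕ}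
    (hf : f ∈ interlacing N r) : Antitone f := by
  rw [mem_interlacing] at hf
  intro i j hij
  rcases hij.eq_or_lt with rfl | h
  · rfl
  · exact ((hf j).2.trans (hr (show (i : ℕ) + 1 ≤ j from h))).trans (hf i).1

namespace BoundedTableau

/-- Restriction of a tableau to a smaller diagram. -/
noncomputable def restrict {mu nu : YoungDiagram} {M N : ℕ} (T : BoundedTableau M mu) (h : nu ≤ mu)
    (hT : ∀ a b, (a, b) ∈ nu → T.1 a b < N) : BoundedTableau N nu :=
  ⟨{ entry := fun a b => open Classical in if (a, b) ∈ nu then T.1 a b else 0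
     row_weak' := by
      intro a b₁ b₂ hb hm
      rw [if_pos hm, if_pos (nu.up_left_mem le_rfl hb.le hm)]
      exact T.1.row_weak hb (h hm)
     col_strict' := by
      intro a₁ a₂ b ha hm
      rw [if_pos hm, if_pos (nu.up_left_mem ha.le le_rfl hm)]
      exact T.1.col_strict ha (h hm)
     zeros' := fun hm => if_neg hm }, by
    rintro ⟨a, b⟩ hc
    have hm := (YoungDiagram.mem_cells _).1 hc
    show (if (a, b) ∈ nu then T.1 a b else 0) < N
    rw [if_pos hm]
    exact hT a b hm⟩

theorem restrict_apply {mu nu : YoungDiagram} {M N : ℕ} (T : BoundedTableau M mu) (h : nu ≤ mu)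
    (hT : ∀ a b, (a, b) ∈ nu → T.1 a b < N) {a b : ℕ} (hm : (a, b) ∈ nu) :
    (T.restrict h hT).1 a b = T.1 a b :=
  if_pos hm

/-- Extension of a tableau to a larger diagram by a new largest letter in a horizontal strip. -/
noncomputable def extend {mu nu : YoungDiagram} {N : ℕ} (T : BoundedTableau N nu)
    (hs : ∀ a₁ a₂ b, a₁ < a₂ → (a₂, b) ∈ mu → (a₁, b) ∈ nu) : BoundedTableau (N + 1) mu :=
  ⟨{ entry := fun a b => open Classical in
        if (a, b) ∈ mu then if (a, b) ∈ nu then T.1 a b else N else 0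
     row_weak' := by
      intro a b₁ b₂ hb hm
      rw [if_pos hm, if_pos (mu.up_left_mem le_rfl hb.le hm)]
      by_cases h₂ : (a, b₂) ∈ nu
      · rw [if_pos h₂, if_pos (nu.up_left_mem le_rfl hb.le h₂)]
        exact T.1.row_weak hb h₂
      · rw [if_neg h₂]
        split_ifs with h₁
        · exact (T.2 (a, b₁) ((YoungDiagram.mem_cells _).2 h₁)).le
        · exact le_rfl
     col_strict' := by
      intro a₁ a₂ b ha hm
      have h₁ := hs a₁ a₂ b ha hm
      rw [if_pos hm, if_pos (mu.up_left_mem ha.le le_rfl hm), if_pos h₁]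
      split_ifs with h₂
      · exact T.1.col_strict ha h₂
      · exact T.2 (a₁, b) ((YoungDiagram.mem_cells _).2 h₁)
     zeros' := fun hm => if_neg hm }, by
    rintro ⟨a, b⟩ hc
    have hm := (YoungDiagram.mem_cells _).1 hc
    show (if (a, b) ∈ mu then if (a, b) ∈ nu then T.1 a b else N else 0) < N + 1
    rw [if_pos hm]
    split_ifs with h
    · exact Nat.lt_succ_of_lt (T.2 (a, b) ((YoungDiagram.mem_cells _).2 h))
    · exact Nat.lt_succ_self N⟩

theorem extend_apply {mu nu : YoungDiagram} {N : ℕ} (T : BoundedTableau N nu)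
    (hs : ∀ a₁ a₂ b, a₁ < a₂ → (a₂, b) ∈ mu → (a₁, b) ∈ nu) {a b : ℕ} (hm : (a, b) ∈ mu) :
    (T.extend hs).1 a b = open Classical in if (a, b) ∈ nu then T.1 a b else N :=
  if_pos hm

theorem ext' {mu : YoungDiagram} {N : ℕ} {S T : BoundedTableau N mu}
    (h : ∀ a b, (a, b) ∈ mu → S.1 a b = T.1 a b) : S = T := by
  refine Subtype.ext (SemistandardYoungTableau.ext fun a b => ?_)
  by_cases hm : (a, b) ∈ mu
  · exact h a b hm
  · rw [S.1.zeros hm, T.1.zeros hm]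

end BoundedTableau

/-- Branching rule: removing the largest letter of a tableau. -/
theorem tableauSum_succ {R : Type*} [CommRing R] (N : ℕ) (mu : YoungDiagram)
    (hmu : ∀ c ∈ mu.cells, c.1 < N + 1) (z : ℕ → R) :
    tableauSum (N + 1) mu z = ∑ f ∈ interlacing N mu.rowLen,
      (z N ^ mu.rowLen N * ∏ j : Fin N, z N ^ (mu.rowLen j - f j)) *
        tableauSum N (diagramOf f) z := by
  classical
  have hanti : Antitone mu.rowLen := fun i j h => mu.rowLen_anti i j h
  have hmaps : ∀ T ∈ (Finset.univ : Finset (BoundedTableau (N + 1) mu)),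
      (fun j : Fin N => initialLen T.1 N j) ∈ interlacing N mu.rowLen := by
    intro T _
    rw [mem_interlacing]
    intro j
    constructor
    · refine le_of_forall_lt fun b hb => ?_
      rw [← YoungDiagram.mem_iff_lt_rowLen] at hb
      rw [lt_initialLen]
      refine ⟨mu.up_left_mem (Nat.le_succ _) le_rfl hb, ?_⟩
      have h1 := T.1.col_strict (Nat.lt_add_one (j : ℕ)) hb
      have h2 := T.2 _ ((YoungDiagram.mem_cells _).2 hb)
      simp only at h2
      omega
    · refine le_of_forall_lt fun b hb => ?_
      rw [lt_initialLen] at hb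
      exact YoungDiagram.mem_iff_lt_rowLen.1 hb.1
  rw [tableauSum, ← Finset.sum_fiberwise_of_maps_to hmaps]
  refine Finset.sum_congr rfl fun f hf => ?_
  have hfa := antitone_of_mem_interlacing hanti hf
  rw [mem_interlacing] at hf
  have hle : diagramOf f ≤ mu := by
    rintro ⟨a, b⟩ hc
    obtain ⟨ha, hb⟩ := (mem_diagramOf hfa).1 hc
    exact YoungDiagram.mem_iff_lt_rowLen.2 (hb.trans_le (hf ⟨a, ha⟩).2)
  -- Interlacing says that the removed cells form a horizontal strip.
  have hs : ∀ a₁ a₂ b, a₁ < a₂ → (a₂, b) ∈ mu → (a₁, b) ∈ diagramOf f := by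
    intro a₁ a₂ b ha hm
    have h1 := hmu _ ((YoungDiagram.mem_cells _).2 hm)
    simp only at h1
    have h2 : a₁ < N := by omega
    refine (mem_diagramOf hfa).2 ⟨h2, lt_of_lt_of_le ?_ (hf ⟨a₁, h2⟩).1⟩
    exact (YoungDiagram.mem_iff_lt_rowLen.1 hm).trans_le (hanti ha)
  have hfib : ∀ T ∈ Finset.univ.filter (fun T : BoundedTableau (N + 1) mu =>
      (fun j : Fin N => initialLen T.1 N j) = f), ∀ a b, (a, b) ∈ mu →
        ((a, b) ∈ diagramOf f ↔ T.1 a b < N) := by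
    intro T hT a b hm
    rw [Finset.mem_filter] at hT
    rw [mem_diagramOf hfa]
    constructor
    · rintro ⟨ha, hb⟩
      rw [← hT.2, lt_initialLen] at hb
      exact hb.2
    · intro h
      -- Entries are at least their row index, so letters `< N` occur only in the first `N` rows.
      have := T.1.le_apply hm
      have ha : a < N := by omega
      refine ⟨ha, ?_⟩
      rw [← hT.2, lt_initialLen]
      exact ⟨hm, h⟩
  rw [tableauSum, Finset.mul_sum]
  refine Finset.sum_bij' (fun T hT => T.restrict hle
      (fun a b hm => (hfib T hT a b (hle hm)).1 hm)) (fun T _ => T.extend hs) ?_ ?_ ?_ ?_ ?_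
  · simp
  · intro T _
    refine Finset.mem_filter.2 ⟨Finset.mem_univ _, ?_⟩
    funext j
    refine eq_of_forall_lt_iff fun b => ?_
    rw [lt_initialLen]
    constructor
    · rintro ⟨hm, h⟩
      rw [BoundedTableau.extend_apply _ _ hm] at h
      split_ifs at h with h'
      · exact ((mem_diagramOf hfa).1 h').2
      · exact absurd h (lt_irrefl _)
    · intro hb
      have hm : ((j : ℕ), b) ∈ diagramOf f := (mem_diagramOf hfa).2 ⟨j.2, hb⟩
      refine ⟨hle hm, ?_⟩
      rw [BoundedTableau.extend_apply _ _ (hle hm), if_pos hm]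
      exact T.2 _ ((YoungDiagram.mem_cells _).2 hm)
  · intro T hT
    refine BoundedTableau.ext' fun a b hm => ?_
    rw [BoundedTableau.extend_apply _ _ hm]
    have h1 := hfib T hT a b hm
    have h2 := T.2 _ ((YoungDiagram.mem_cells _).2 hm)
    simp only at h2
    split_ifs with h
    · exact BoundedTableau.restrict_apply _ _ _ h
    · rw [h1] at h; omega
  · intro T _
    refine BoundedTableau.ext' fun a b hm => ?_
    rw [BoundedTableau.restrict_apply _ _ _ hm, BoundedTableau.extend_apply _ _ (hle hm), if_pos hm]
  · intro T hT
    rw [YoungDiagram.prod_cells mu hmu, Finset.prod_range_succ,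
      YoungDiagram.prod_cells (diagramOf f) (K := N)
        (fun c hc => ((mem_diagramOf hfa).1 ((YoungDiagram.mem_cells c).1 hc)).1)]
    have hN : ∀ a b, (a, b) ∈ mu → (a, b) ∉ diagramOf f → T.1 a b = N := by
      intro a b hm h
      have h2 := T.2 _ ((YoungDiagram.mem_cells _).2 hm)
      rw [hfib T hT a b hm] at h
      simp only at h2
      omega
    have hlast : ∏ b ∈ Finset.range (mu.rowLen N), z (T.1 N b) = z N ^ mu.rowLen N := by
      rw [Finset.prod_congr rfl (g := fun _ => z N)]
      · simp
      · intro b hb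
        rw [hN N b (YoungDiagram.mem_iff_lt_rowLen.2 (Finset.mem_range.1 hb))]
        intro h
        exact absurd ((mem_diagramOf hfa).1 h).1 (lt_irrefl _)
    rw [hlast, mul_comm, mul_assoc, Finset.prod_range, Finset.prod_range,
      ← Finset.prod_mul_distrib]
    congr 1
    refine Finset.prod_congr rfl fun j _ => ?_
    rw [← Finset.prod_range_mul_prod_Ico _ (hf j).2, rowLen_diagramOf hfa, mul_comm]
    congr 1
    · rw [Finset.prod_congr rfl (g := fun _ => z N)]
      · simp
      · intro b hb
        rw [Finset.mem_Ico] at hb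
        rw [hN j b (YoungDiagram.mem_iff_lt_rowLen.2 hb.2)]
        intro h
        obtain ⟨_, h⟩ := (mem_diagramOf hfa).1 h
        exact absurd h (not_lt.2 hb.1)
    · refine Finset.prod_congr rfl fun b hb => ?_
      rw [BoundedTableau.restrict_apply]
      exact (mem_diagramOf hfa).2 ⟨j.2, Finset.mem_range.1 hb⟩

/-! ### Alternants and the bialternant formula. -/

/-- The determinant of the powers `z i ^ f j`. -/
def alternant {R : Type*} [CommRing R] {N : ℕ} (f : Fin N → ℕ) (z : ℕ → R) : R :=
  (Matrix.of fun i j : Fin N => z i ^ f j).det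

/-- The Vandermonde product `∏_{i < j} (z i - z j)`. -/
def vandermondeProd {R : Type*} [CommRing R] (z : ℕ → R) : ℕ → R
  | 0 => 1
  | N + 1 => vandermondeProd z N * ∏ i : Fin N, (z i - z N)

/-- Reversing rows and columns reduces this to `Matrix.det_eq_of_forall_col_eq_smul_add_pred`. -/
theorem Matrix.det_eq_of_forall_col_eq_smul_add_succ {R : Type*} [CommRing R] {n : ℕ}
    {A B : Matrix (Fin (n + 1)) (Fin (n + 1)) R} (c : Fin n → R)
    (A_last : ∀ i, A i (Fin.last n) = B i (Fin.last n))
    (A_castSucc : ∀ i (j : Fin n), A i j.castSucc = B i j.castSucc + c j * A i j.succ) :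
    A.det = B.det := by
  rw [← Matrix.det_submatrix_equiv_self Fin.revPerm A,
    ← Matrix.det_submatrix_equiv_self Fin.revPerm B]
  refine Matrix.det_eq_of_forall_col_eq_smul_add_pred (fun j => c j.rev) ?_ ?_
  · intro i
    simp [A_last]
  · intro i j
    simp [A_castSucc, Fin.rev_succ, Fin.rev_castSucc]

theorem sub_mul_sum_Icc {R : Type*} [CommRing R] (x y : R) {a b : ℕ} (h : a ≤ b) (e : ℕ) :
    (x - y) * ∑ f ∈ Finset.Icc a b, y ^ (b - f) * x ^ (f + e) =
      x ^ (b + e + 1) - y ^ (b - a + 1) * x ^ (a + e) := by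
  induction b, h using Nat.le_induction with
  | base => simp; ring
  | succ b h ih =>
    rw [Finset.sum_Icc_succ_top (by omega), mul_add,
      Finset.sum_congr rfl (g := fun f => y * (y ^ (b - f) * x ^ (f + e))), ← Finset.mul_sum,
      mul_left_comm, ih]
    · rw [show b + 1 - a = b - a + 1 by omega, Nat.sub_self]
      ring
    · intro f hf
      rw [Finset.mem_Icc] at hf
      rw [show b + 1 - f = b - f + 1 by omega]
      ring

theorem Matrix.det_of_sum {R : Type*} [CommRing R] {N : ℕ} (A : Fin N → Finset ℕ)
    (g : Fin N → Fin N → ℕ → R) :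
    (Matrix.of fun i j => ∑ f ∈ A j, g i j f).det =
      ∑ r ∈ Fintype.piFinset A, (Matrix.of fun i j => g i j (r j)).det := by
  have h := MultilinearMap.map_sum_finset
    (Matrix.detRowAlternating (n := Fin N) (R := R)).toMultilinearMap
    (fun j f => fun i => g i j f) A
  rw [← Matrix.det_transpose]
  refine Eq.trans ?_ (h.trans ?_)
  · refine congrArg Matrix.det ?_
    ext i j
    simp
  · refine Finset.sum_congr rfl fun r _ => ?_
    rw [← Matrix.det_transpose]
    rfl

/-- The alternant obeys the same recursion as `tableauSum_succ`, up to the new Vandermonde factors.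
Subtracting a multiple of the next column from each column clears the last row except for its last
entry. The remaining entries are `z i - z N` times geometric sums, and multilinearity in the columns
expands these over the interlacing sequences. -/
theorem alternant_succ {R : Type*} [CommRing R] {N : ℕ} {r : ℕ → ℕ} (hr : Antitone r)
    (z : ℕ → R) :
    alternant (fun j : Fin (N + 1) => r j + (N - j)) z =
      (∏ i : Fin N, (z i - z N)) * ∑ f ∈ interlacing N r,
        (z N ^ r N * ∏ j : Fin N, z N ^ (r j - f j)) *
          alternant (fun j : Fin N => f j + (N - 1 - j)) z := by
  set M : Matrix (Fin (N + 1)) (Fin (N + 1)) R :=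
    Matrix.of fun i j : Fin (N + 1) => z i ^ (r j + (N - j)) with hM
  -- The ratio of the entries of the last row in columns `j` and `j + 1`.
  set c : Fin N → R := fun j => z N ^ (r j - r (j + 1) + 1) with hc
  set B : Matrix (Fin (N + 1)) (Fin (N + 1)) R := Matrix.of fun i j =>
    Fin.lastCases (M i (Fin.last N)) (fun j => M i j.castSucc - c j * M i j.succ) j with hB
  have hMB : M.det = B.det := by
    refine Matrix.det_eq_of_forall_col_eq_smul_add_succ c ?_ ?_ <;> simp [hB]
  have hBc : ∀ i (j : Fin N), B i j.castSucc = (z i - z N) *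
      ∑ f ∈ Finset.Icc (r (j + 1)) (r j), z N ^ (r j - f) * z i ^ (f + (N - 1 - j)) := by
    intro i j
    have hj := j.2
    rw [sub_mul_sum_Icc _ _ (hr (Nat.le_succ _))]
    simp only [hB, hM, hc, Matrix.of_apply, Fin.lastCases_castSucc, Fin.val_castSucc, Fin.val_succ]
    rw [show r j + (N - 1 - j) + 1 = r j + (N - j) by omega,
      show N - (j + 1) = N - 1 - j by omega]
  have hdet : B.det = z N ^ r N * (B.submatrix Fin.castSucc Fin.castSucc).det := by
    rw [Matrix.det_succ_row B (Fin.last N), Fin.sum_univ_castSucc, Finset.sum_eq_zero]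
    · simp [hB, hM, ← two_mul, Fin.succAbove_last]
    · intro j _
      rw [hBc]
      simp
  have hsub : B.submatrix Fin.castSucc Fin.castSucc = Matrix.of fun i j : Fin N =>
      (z i - z N) * (Matrix.of fun i j : Fin N => ∑ f ∈ Finset.Icc (r (j + 1)) (r j),
        z N ^ (r j - f) * z i ^ (f + (N - 1 - j))) i j := by
    ext i j
    simp [hBc]
  show M.det = _
  rw [hMB, hdet, hsub, Matrix.det_mul_column, Matrix.det_of_sum, mul_left_comm, Finset.mul_sum,
    interlacing]
  congr 1
  refine Finset.sum_congr rfl fun f _ => ?_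
  rw [mul_assoc]
  congr 1
  exact Matrix.det_mul_row (fun j : Fin N => z N ^ (r j - f j)) _

/-- The bialternant formula. -/
theorem vandermondeProd_mul_tableauSum {R : Type*} [CommRing R] (z : ℕ → R) (N : ℕ)
    (mu : YoungDiagram) (hmu : ∀ c ∈ mu.cells, c.1 < N) :
    vandermondeProd z N * tableauSum N mu z =
      alternant (fun j : Fin N => mu.rowLen j + (N - 1 - j)) z := by
  induction N generalizing mu with
  | zero =>
    have h0 : mu.cells = ∅ := Finset.eq_empty_of_forall_notMem fun c hc => by simpa using hmu c hc
    have : Unique (BoundedTableau 0 mu) :=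
      ⟨⟨⟨default, fun c hc => by simp [h0] at hc⟩⟩, fun T => BoundedTableau.ext' fun a b hm => by
        rw [← YoungDiagram.mem_cells, h0] at hm; simp at hm⟩
    simp [vandermondeProd, alternant, tableauSum, h0]
  | succ N ih =>
    have hanti : Antitone mu.rowLen := fun i j h => mu.rowLen_anti i j h
    rw [tableauSum_succ N mu hmu, vandermondeProd]
    simp only [Nat.add_sub_cancel]
    rw [alternant_succ hanti, mul_right_comm, mul_comm, Finset.mul_sum]
    congr 1
    refine Finset.sum_congr rfl fun f hf => ?_
    have hfa := antitone_of_mem_interlacing hanti hf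
    rw [mul_left_comm, ih]
    · simp only [rowLen_diagramOf hfa]
    · exact fun c hc => ((mem_diagramOf hfa).1 ((YoungDiagram.mem_cells c).1 hc)).1

theorem alternant_comp_perm {R : Type*} [CommRing R] {N : ℕ} (f : Fin N → ℕ) (z : ℕ → R)
    (σ : Equiv.Perm (Fin N)) :
    alternant (f ∘ σ) z = Equiv.Perm.sign σ * alternant f z :=
  Matrix.det_permute' σ (Matrix.of fun i j : Fin N => z i ^ f j)

theorem alternant_eq_zero {R : Type*} [CommRing R] {N : ℕ} {f : Fin N → ℕ} (z : ℕ → R)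
    {i j : Fin N} (hij : i ≠ j) (h : f i = f j) : alternant f z = 0 :=
  Matrix.det_zero_of_column_eq hij fun k => by simp [h]

theorem alternant_add_one {R : Type*} [CommRing R] {N : ℕ} (f : Fin N → ℕ) (z : ℕ → R) :
    alternant (fun j => f j + 1) z = (∏ i : Fin N, z i) * alternant f z := by
  rw [alternant, alternant, ← Matrix.det_mul_column]
  congr 1
  ext i j
  simp [pow_succ']

/-- The Plücker relation for alternants. -/
theorem alternant_mul_alternant {R : Type*} [CommRing R] [IsDomain R] {N : ℕ} (f g : Fin N → ℕ)
    (z : ℕ → R) (I : Finset (Fin N)) (σ : Finset (Fin N) → Equiv.Perm (Fin N))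
    (hσ : ∀ J, J.card = I.card → ∀ t, σ J t ∈ I ↔ t ∈ J) :
    alternant f z * alternant g z = ∑ J ∈ Finset.powersetCard I.card Finset.univ,
      alternant (fun j => if j ∈ I then g ((σ J).symm j) else f j) z *
        alternant (fun j => if j ∈ J then f (σ J j) else g j) z := by
  rw [alternant, alternant, Matrix.det_mul_det_exchange _ _ I σ hσ]
  refine Finset.sum_congr rfl fun J _ => ?_
  congr 2 <;> ext i j <;> simp only [Matrix.of_apply] <;> split_ifs <;> rfl

/-! ### Boards encoded by corners and their row lengths under a strip. -/

namespace Corners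

/-- The sequences `x`, `y` encode a partition, with the convention `x_(n+1) = 0`. -/
structure Valid (c : Corners) : Prop where
  x_last : c.x (c.n + 1) = 0
  x_anti : ∀ p, 1 ≤ p → p ≤ c.n → c.x (p + 1) ≤ c.x p
  y_nonneg : 0 ≤ c.y 1
  y_mono : ∀ p, 1 ≤ p → p < c.n → c.y p ≤ c.y (p + 1)

/-- The points are the outside corners of a partition. -/
structure Strict (c : Corners) : Prop where
  x_last : c.x (c.n + 1) = 0
  x_anti : ∀ p, 1 ≤ p → p ≤ c.n → c.x (p + 1) < c.x p
  y_pos : 0 < c.y 1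
  y_mono : ∀ p, 1 ≤ p → p < c.n → c.y p < c.y (p + 1)

theorem Strict.valid {c : Corners} (h : c.Strict) : c.Valid :=
  ⟨h.x_last, fun p h1 h2 => (h.x_anti p h1 h2).le, h.y_pos.le, fun p h1 h2 => (h.y_mono p h1 h2).le⟩

/-- Row `t` meets the rectangle number `p` in the decomposition of the board by heights; the
number `n + 1` stands for the empty rows. -/
structure InBlock (c : Corners) (p t : ℕ) : Prop where
  one_le : 1 ≤ p
  le : p ≤ c.n + 1
  lower : 1 < p → c.y (p - 1) ≤ t
  upper : p ≤ c.n → (t : ℤ) < c.y p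

theorem Valid.x_le {c : Corners} (hc : c.Valid) {p q : ℕ} (hp : 1 ≤ p) (hpq : p ≤ q)
    (hq : q ≤ c.n + 1) : c.x q ≤ c.x p := by
  induction q, hpq using Nat.le_induction with
  | base => exact le_rfl
  | succ q h ih => exact (hc.x_anti q (by omega) (by omega)).trans (ih (by omega))

theorem Valid.y_le {c : Corners} (hc : c.Valid) {p q : ℕ} (hp : 1 ≤ p) (hpq : p ≤ q)
    (hq : q ≤ c.n) : c.y p ≤ c.y q := by
  induction q, hpq using Nat.le_induction with
  | base => exact le_rfl
  | succ q h ih => exact (ih (by omega)).trans (hc.y_mono q (by omega) (by omega))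

theorem exists_inBlock (c : Corners) (t : ℕ) : ∃ p, c.InBlock p t := by
  classical
  have h : ∃ p, 1 ≤ p ∧ (p ≤ c.n → (t : ℤ) < c.y p) := ⟨c.n + 1, by omega, by omega⟩
  -- Minimality of the block number gives the lower bound on `t`.
  refine ⟨Nat.find h, (Nat.find_spec h).1, Nat.find_min' h ⟨by omega, by omega⟩, ?_,
    (Nat.find_spec h).2⟩
  intro h1
  have h2 := Nat.find_min h (m := Nat.find h - 1) (by omega)
  push Not at h2
  exact (h2 (by omega)).2

theorem Valid.inBlock_le {c : Corners} (hc : c.Valid) {p q t : ℕ} (h : c.InBlock p t) (hq : 1 ≤ q)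
    (ht : (t : ℤ) < c.y q) : p ≤ q := by
  by_contra! hpq
  have h1 := h.lower (by omega)
  have h2 := hc.y_le hq (show q ≤ p - 1 by omega) (by have := h.le; omega)
  omega

theorem Valid.lt_inBlock {c : Corners} {p q t : ℕ} (hc : c.Valid) (h : c.InBlock p t)
    (hq' : q ≤ c.n) (ht : c.y q ≤ t) : q < p := by
  by_contra! hpq
  have h1 := h.upper (by omega)
  have h2 := hc.y_le h.one_le hpq hq'
  omega

theorem mem_board {c : Corners} {a b : ℕ} :
    (a, b) ∈ c.board ↔ ∃ p, (1 ≤ p ∧ p ≤ c.n) ∧ (a : ℤ) < c.y p ∧ (b : ℤ) < c.x p := by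
  rw [← YoungDiagram.mem_cells]
  simp [board]

/-- Since `x` decreases, the first rectangle that reaches row `t` is the widest one that does. -/
theorem rowLen_board {c : Corners} (hc : c.Valid) {p t : ℕ} (h : c.InBlock p t) :
    (c.board.rowLen t : ℤ) = c.x p := by
  have h0 : 0 ≤ c.x p := hc.x_last ▸ hc.x_le h.one_le h.le le_rfl
  rw [← Int.toNat_of_nonneg h0, Nat.cast_inj]
  refine eq_of_forall_lt_iff fun b => ?_
  rw [← YoungDiagram.mem_iff_lt_rowLen, mem_board, Int.lt_toNat]
  constructor
  · rintro ⟨q, ⟨h1, h2⟩, h3, h4⟩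
    exact h4.trans_le (hc.x_le h.one_le (hc.inBlock_le h h1 h3) (by omega))
  · intro hb
    have hp : p ≤ c.n := by
      by_contra! hp
      have : p = c.n + 1 := le_antisymm h.le hp
      rw [this, hc.x_last] at hb
      omega
    exact ⟨p, ⟨h.one_le, hp⟩, h.upper hp, hb⟩

/-- The conditions under which `strip d i j` acts on the board by a border strip from the last row
of block `i` (row `p`) to the first row of block `j + 1` (row `q`). -/
structure Strippable (c : Corners) (i j p q : ℕ) : Prop where
  one_le : 1 ≤ i
  i_le_j : i ≤ j
  j_le : j ≤ c.n
  y_i : c.y i = p + 1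
  y_j : c.y j = q
  y_pred : 1 < i → c.y (i - 1) ≤ p
  y_succ : j < c.n → (q : ℤ) < c.y (j + 1)
  x_i : i < j → c.x (i + 1) < c.x i
  x_j : i < j → c.x (j + 1) < c.x j

theorem Strippable.lt {c : Corners} (hc : c.Valid) {i j p q : ℕ} (h : c.Strippable i j p q) :
    p < q := by
  have := hc.y_le h.one_le h.i_le_j h.j_le
  rw [h.y_i, h.y_j] at this
  omega

/-- Successive differences change only at the ends of the shifted ranges, by one, and there
`Strippable` makes them strict. -/
theorem valid_strip {c : Corners} (hc : c.Valid) {i j p q : ℕ} (h : c.Strippable i j p q) {d : ℤ}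
    (hd : d = 1 ∨ d = -1) : (strip d i j c).Valid := by
  obtain ⟨h1, h2, h3, h4, h5, h6, h7, h8, h9⟩ := h
  refine ⟨?_, ?_, ?_, ?_⟩
  · have := hc.x_last
    simp only [strip]
    rw [if_neg (by omega)]
    exact this
  · intro r hr hrn
    have := hc.x_anti r hr hrn
    simp only [strip] at hrn ⊢
    by_cases e1 : r = i
    · subst e1
      split_ifs <;> rcases hd with rfl | rfl <;> omega
    by_cases e2 : r = j
    · subst e2
      split_ifs <;> rcases hd with rfl | rfl <;> omega
    split_ifs <;> rcases hd with rfl | rfl <;> omega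
  · have := hc.y_nonneg
    simp only [strip]
    by_cases e1 : i = 1
    · subst e1
      split_ifs <;> rcases hd with rfl | rfl <;> omega
    · rw [if_neg (by omega)]
      exact this
  · intro r hr hrn
    have := hc.y_mono r hr hrn
    simp only [strip] at hrn ⊢
    by_cases e1 : r = j
    · subst e1
      split_ifs <;> rcases hd with rfl | rfl <;> omega
    by_cases e2 : r + 1 = i
    · subst e2
      simp only [Nat.add_sub_cancel] at h6
      split_ifs <;> rcases hd with rfl | rfl <;> omega
    split_ifs <;> rcases hd with rfl | rfl <;> omega

section Rows

variable {c : Corners} {i j p q : ℕ}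

/-- Adding the strip gives block `i` one more row and moves blocks `i + 1, …, j` down by one row
while widening them by one column; block `j + 1` loses its first row `q`. This and the next three
lemmas read this off row by row. -/
theorem rowLen_piOp_of_le (hc : c.Valid) (h : c.Strippable i j p q) {t : ℕ} (ht : t ≤ p) :
    (strip 1 i j c).board.rowLen t = c.board.rowLen t := by
  obtain ⟨r, hr⟩ := c.exists_inBlock t
  have hri := hc.inBlock_le hr h.one_le (by rw [h.y_i]; omega)
  have hr' : (strip 1 i j c).InBlock r t := by
    refine ⟨hr.one_le, hr.le, fun h1 => ?_, fun h1 => ?_⟩ <;> simp only [strip] at h1 ⊢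
    · rw [if_neg (by omega)]; exact hr.lower h1
    · have := hr.upper h1
      split_ifs <;> omega
  zify
  rw [rowLen_board hc hr, rowLen_board (valid_strip hc h (Or.inl rfl)) hr']
  simp only [strip]
  rw [if_neg (by omega)]

theorem rowLen_piOp_succ (hc : c.Valid) (h : c.Strippable i j p q) :
    (strip 1 i j c).board.rowLen (p + 1) = c.board.rowLen p := by
  have hr : c.InBlock i p :=
    ⟨h.one_le, by have := h.i_le_j; have := h.j_le; omega, h.y_pred, fun _ => by rw [h.y_i]; omega⟩
  have hr' : (strip 1 i j c).InBlock i (p + 1) := by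
    refine ⟨hr.one_le, hr.le, fun h1 => ?_, fun h1 => ?_⟩ <;> simp only [strip] at h1 ⊢
    · rw [if_neg (by omega)]
      have := hr.lower h1
      omega
    · have := h.y_i
      rw [if_pos ⟨le_rfl, h.i_le_j⟩]
      omega
  zify
  rw [rowLen_board hc hr, rowLen_board (valid_strip hc h (Or.inl rfl)) hr']
  simp only [strip]
  rw [if_neg (by omega)]

theorem rowLen_piOp_add_one (hc : c.Valid) (h : c.Strippable i j p q) {t : ℕ} (hpt : p < t)
    (htq : t < q) :
    (strip 1 i j c).board.rowLen (t + 1) = c.board.rowLen t + 1 := by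
  obtain ⟨r, hr⟩ := c.exists_inBlock t
  have hir := hc.lt_inBlock hr (h.i_le_j.trans h.j_le) (by rw [h.y_i]; omega)
  have hrj := hc.inBlock_le hr (h.one_le.trans h.i_le_j) (by rw [h.y_j]; omega)
  have hr' : (strip 1 i j c).InBlock r (t + 1) := by
    refine ⟨hr.one_le, hr.le, fun h1 => ?_, fun h1 => ?_⟩ <;> simp only [strip] at h1 ⊢
    · have := hr.lower h1
      split_ifs <;> omega
    · have := hr.upper h1
      split_ifs <;> omega
  zify
  rw [rowLen_board hc hr, rowLen_board (valid_strip hc h (Or.inl rfl)) hr']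
  simp only [strip]
  rw [if_pos (by omega)]

theorem rowLen_piOp_of_lt (hc : c.Valid) (h : c.Strippable i j p q) {t : ℕ} (ht : q < t) :
    (strip 1 i j c).board.rowLen t = c.board.rowLen t := by
  obtain ⟨r, hr⟩ := c.exists_inBlock t
  have hrj := hc.lt_inBlock hr h.j_le (by rw [h.y_j]; omega)
  have hr' : (strip 1 i j c).InBlock r t := by
    refine ⟨hr.one_le, hr.le, fun h1 => ?_, fun h1 => ?_⟩ <;> simp only [strip] at h1 ⊢
    · have h2 := hr.lower h1
      split_ifs with h3
      · have h4 : r - 1 = j := by omega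
        rw [h4, h.y_j]
        omega
      · exact h2
    · have := hr.upper h1
      split_ifs <;> omega
  zify
  rw [rowLen_board hc hr, rowLen_board (valid_strip hc h (Or.inl rfl)) hr']
  simp only [strip]
  rw [if_neg (by omega)]

/-- Removal is the mirror image: block `i` loses its last row `p`, blocks `i + 1, …, j` move up and
get narrower, and block `j + 1` gains row `q - 1`. -/
theorem rowLen_muOp_of_lt (hc : c.Valid) (h : c.Strippable i j p q) {t : ℕ} (ht : t < p) :
    (strip (-1) i j c).board.rowLen t = c.board.rowLen t := by
  obtain ⟨r, hr⟩ := c.exists_inBlock t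
  have hri := hc.inBlock_le hr h.one_le (by rw [h.y_i]; omega)
  have hr' : (strip (-1) i j c).InBlock r t := by
    refine ⟨hr.one_le, hr.le, fun h1 => ?_, fun h1 => ?_⟩ <;> simp only [strip] at h1 ⊢
    · rw [if_neg (by omega)]; exact hr.lower h1
    · have h2 := hr.upper h1
      split_ifs with h3
      · have h4 : r = i := by omega
        rw [h4, h.y_i]
        omega
      · exact h2
  zify
  rw [rowLen_board hc hr, rowLen_board (valid_strip hc h (Or.inr rfl)) hr']
  simp only [strip]
  rw [if_neg (by omega)]

theorem rowLen_muOp_add_one (hc : c.Valid) (h : c.Strippable i j p q) {t : ℕ} (hpt : p ≤ t)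
    (htq : t + 1 < q) :
    (strip (-1) i j c).board.rowLen t + 1 = c.board.rowLen (t + 1) := by
  obtain ⟨r, hr⟩ := c.exists_inBlock (t + 1)
  have hir := hc.lt_inBlock hr (h.i_le_j.trans h.j_le) (by rw [h.y_i]; omega)
  have hrj := hc.inBlock_le hr (h.one_le.trans h.i_le_j) (by rw [h.y_j]; omega)
  have hr' : (strip (-1) i j c).InBlock r t := by
    refine ⟨hr.one_le, hr.le, fun h1 => ?_, fun h1 => ?_⟩ <;> simp only [strip] at h1 ⊢
    · have := hr.lower h1
      split_ifs <;> omega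
    · have := hr.upper h1
      split_ifs <;> omega
  zify
  have h1 := rowLen_board hc hr
  rw [h1, rowLen_board (valid_strip hc h (Or.inr rfl)) hr']
  simp only [strip]
  rw [if_pos (by omega)]
  ring

theorem rowLen_muOp_pred (hc : c.Valid) (h : c.Strippable i j p q) :
    (strip (-1) i j c).board.rowLen (q - 1) = c.board.rowLen q := by
  have hpq := h.lt hc
  have hij := h.i_le_j
  have hj := h.j_le
  have hi := h.one_le
  have hr : c.InBlock (j + 1) q :=
    ⟨by omega, by omega, fun _ => by simp [h.y_j], fun h1 => h.y_succ (by omega)⟩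
  have hr' : (strip (-1) i j c).InBlock (j + 1) (q - 1) := by
    refine ⟨hr.one_le, hr.le, fun h1 => ?_, fun h1 => ?_⟩ <;>
      simp only [strip, Nat.add_sub_cancel] at h1 ⊢
    · rw [if_pos (by omega), h.y_j]
      omega
    · have := h.y_succ (by omega)
      rw [if_neg (by omega)]
      omega
  zify
  rw [rowLen_board hc hr, rowLen_board (valid_strip hc h (Or.inr rfl)) hr']
  simp only [strip]
  rw [if_neg (by omega)]

theorem rowLen_muOp_of_le (hc : c.Valid) (h : c.Strippable i j p q) {t : ℕ} (ht : q ≤ t) :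
    (strip (-1) i j c).board.rowLen t = c.board.rowLen t := by
  obtain ⟨r, hr⟩ := c.exists_inBlock t
  have hrj := hc.lt_inBlock hr h.j_le (by rw [h.y_j]; omega)
  have hr' : (strip (-1) i j c).InBlock r t := by
    refine ⟨hr.one_le, hr.le, fun h1 => ?_, fun h1 => ?_⟩ <;> simp only [strip] at h1 ⊢
    · have h2 := hr.lower h1
      split_ifs <;> omega
    · have := hr.upper h1
      split_ifs <;> omega
  zify
  rw [rowLen_board hc hr, rowLen_board (valid_strip hc h (Or.inr rfl)) hr']
  simp only [strip]
  rw [if_neg (by omega)]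

end Rows

/-! ### Border strips as replacements of exponents. -/

/-- The exponents in the bialternant formula for the board. -/
def exps (M : ℕ) (c : Corners) (t : Fin (M + 1)) : ℕ := c.board.rowLen t + (M - t)

/-- A row that moves down by one and grows by one keeps its exponent. Only the exponent of row `q`
disappears, and the new row `p + 1` has that of row `p` minus one. The cycle on `p + 1, …, q`
records the move. -/
theorem exists_perm_exps_piOp {M : ℕ} {c : Corners} (hc : c.Valid) {i j : ℕ} {p q : Fin (M + 1)}
    (h : c.Strippable i j p q) :
    ∃ τ : Equiv.Perm (Fin (M + 1)), Equiv.Perm.sign τ = (-1) ^ ((q : ℕ) - p - 1) ∧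
      (∀ t, t < p → τ t = t) ∧ (∀ t, q < t → τ t = t) ∧
      exps M (strip 1 i j c) (τ q) + 1 = exps M c p ∧
      ∀ t, t ≠ q → exps M (strip 1 i j c) (τ t) = exps M c t := by
  have hpq : (p : ℕ) < q := h.lt hc
  have hq := q.2
  set p' : Fin (M + 1) := ⟨p + 1, by omega⟩ with hp'
  have hp'q : p' ≤ q := Fin.le_def.2 (by simp [hp']; omega)
  refine ⟨Fin.cycleIcc p' q, ?_, ?_, ?_, ?_, ?_⟩
  · rw [Fin.sign_cycleIcc_of_le hp'q]
    congr 1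
  · intro t ht
    exact Fin.cycleIcc_of_lt (by rw [Fin.lt_def] at ht ⊢; simp [hp']; omega)
  · intro t ht
    exact Fin.cycleIcc_of_gt ht
  · rw [Fin.cycleIcc_of_last hp'q, exps, exps]
    simp only [hp']
    rw [rowLen_piOp_succ hc h]
    omega
  · intro t htq
    have htq' : (t : ℕ) ≠ q := fun h => htq (Fin.ext h)
    rcases lt_trichotomy (t : ℕ) (q : ℕ) with h1 | h1 | h1
    · by_cases h2 : (p : ℕ) < t
      · rw [Fin.cycleIcc_of_ge_of_lt (Fin.le_def.2 (by simp [hp']; omega)) h1, exps, exps]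
        have h3 : ((t + 1 : Fin (M + 1)) : ℕ) = t + 1 :=
          Fin.val_add_one_of_lt (Fin.lt_def.2 (by simp; omega))
        rw [h3, rowLen_piOp_add_one hc h h2 h1]
        omega
      · rw [Fin.cycleIcc_of_lt (Fin.lt_def.2 (by simp [hp']; omega)), exps, exps,
          rowLen_piOp_of_le hc h (by omega)]
    · exact absurd h1 htq'
    · rw [Fin.cycleIcc_of_gt h1, exps, exps, rowLen_piOp_of_lt hc h h1]

/-- Here the exponent of row `p` disappears and row `q - 1` receives that of row `q` plus one. The
inverse cycle on `p, …, q - 1` has the same length as the cycle for addition, so the signs agree. -/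
theorem exists_perm_exps_muOp {M : ℕ} {c : Corners} (hc : c.Valid) {i j : ℕ} {p q : Fin (M + 1)}
    (h : c.Strippable i j p q) :
    ∃ τ : Equiv.Perm (Fin (M + 1)), Equiv.Perm.sign τ = (-1) ^ ((q : ℕ) - p - 1) ∧
      (∀ t, t < p → τ t = t) ∧ (∀ t, q < t → τ t = t) ∧
      exps M (strip (-1) i j c) (τ p) = exps M c q + 1 ∧
      ∀ t, t ≠ p → exps M (strip (-1) i j c) (τ t) = exps M c t := by
  have hpq : (p : ℕ) < q := h.lt hc
  have hq := q.2
  set q' : Fin (M + 1) := ⟨q - 1, by omega⟩ with hq'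
  have hpq' : p ≤ q' := Fin.le_def.2 (by simp [hq']; omega)
  refine ⟨(Fin.cycleIcc p q')⁻¹, ?_, ?_, ?_, ?_, ?_⟩
  · rw [Equiv.Perm.sign_inv, Fin.sign_cycleIcc_of_le hpq']
    congr 1
    simp [hq']
    omega
  · intro t ht
    rw [Equiv.Perm.inv_eq_iff_eq, Fin.cycleIcc_of_lt ht]
  · intro t ht
    rw [Equiv.Perm.inv_eq_iff_eq, Fin.cycleIcc_of_gt]
    rw [Fin.lt_def] at ht ⊢
    simp [hq']
    omega
  · rw [show (Fin.cycleIcc p q')⁻¹ p = q' from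
      Equiv.Perm.inv_eq_iff_eq.2 (Fin.cycleIcc_of_last hpq').symm, exps, exps]
    simp only [hq']
    rw [rowLen_muOp_pred hc h]
    omega
  · intro t htp
    have htp' : (t : ℕ) ≠ p := fun h => htp (Fin.ext h)
    rcases lt_trichotomy (t : ℕ) (p : ℕ) with h1 | h1 | h1
    · rw [show (Fin.cycleIcc p q')⁻¹ t = t from
        Equiv.Perm.inv_eq_iff_eq.2 (Fin.cycleIcc_of_lt h1).symm, exps, exps,
        rowLen_muOp_of_lt hc h h1]
    · exact absurd h1 htp'
    · by_cases h2 : (t : ℕ) < q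
      · have ht := t.2
        set s : Fin (M + 1) := ⟨t - 1, by omega⟩ with hs
        have hst : s + 1 = t := by
          ext
          rw [Fin.val_add_one_of_lt (Fin.lt_def.2 (by simp [hs]; omega))]
          simp [hs]
          omega
        rw [show (Fin.cycleIcc p q')⁻¹ t = s from
          Equiv.Perm.inv_eq_iff_eq.2 (by
            rw [Fin.cycleIcc_of_ge_of_lt (Fin.le_def.2 (by simp [hs]; omega))
              (Fin.lt_def.2 (by simp [hs, hq']; omega)), hst]), exps, exps]
        have h3 := rowLen_muOp_add_one hc h (t := s) (by simp [hs]; omega) (by simp [hs]; omega)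
        have h4 : (s : ℕ) + 1 = t := by simp [hs]; omega
        rw [h4] at h3
        omega
      · rw [show (Fin.cycleIcc p q')⁻¹ t = t from
          Equiv.Perm.inv_eq_iff_eq.2 (Fin.cycleIcc_of_gt (Fin.lt_def.2 (by simp [hq']; omega))).symm,
          exps, exps, rowLen_muOp_of_le hc h (by omega)]

end Corners

namespace Corners

/-- Uniform version of both cases: `u` is the row whose exponent is lost, `v` the row that supplies
its replacement. -/
theorem exists_perm_exps_strip {M : ℕ} {c : Corners} (hc : c.Valid) {i j : ℕ} {p q : Fin (M + 1)}
    (h : c.Strippable i j p q) {d : ℤ} {u v : Fin (M + 1)}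
    (hd : (d = 1 ∧ u = q ∧ v = p) ∨ (d = -1 ∧ u = p ∧ v = q)) :
    ∃ τ : Equiv.Perm (Fin (M + 1)), Equiv.Perm.sign τ = (-1) ^ ((q : ℕ) - p - 1) ∧
      (∀ t, t < p → τ t = t) ∧ (∀ t, q < t → τ t = t) ∧
      (exps M (strip d i j c) (τ u) : ℤ) = exps M c v - d ∧
      ∀ t, t ≠ u → exps M (strip d i j c) (τ t) = exps M c t := by
  rcases hd with ⟨rfl, rfl, rfl⟩ | ⟨rfl, rfl, rfl⟩
  · obtain ⟨τ, h1, h2, h3, h4, h5⟩ := exists_perm_exps_piOp hc h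
    exact ⟨τ, h1, h2, h3, by omega, h5⟩
  · obtain ⟨τ, h1, h2, h3, h4, h5⟩ := exists_perm_exps_muOp hc h
    exact ⟨τ, h1, h2, h3, by omega, h5⟩

/-- The common generalization of `piNested` and `muNested`. -/
def stripNested (d : ℤ) {m : ℕ} (i j : Fin m → ℕ) : Corners → Corners :=
  (List.ofFn fun r => strip d (i r) (j r)).foldr (fun f g => f ∘ g) id

theorem piNested_eq {m : ℕ} (i j : Fin m → ℕ) : piNested i j = stripNested 1 i j := rfl

theorem muNested_eq {m : ℕ} (i j : Fin m → ℕ) : muNested i j = stripNested (-1) i j := rfl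

theorem stripNested_zero (d : ℤ) (i j : Fin 0 → ℕ) (c : Corners) : stripNested d i j c = c := by
  simp [stripNested]

theorem stripNested_succ (d : ℤ) {m : ℕ} (i j : Fin (m + 1) → ℕ) (c : Corners) :
    stripNested d i j c =
      strip d (i 0) (j 0) (stripNested d (fun r => i r.succ) (fun r => j r.succ) c) := by
  simp [stripNested, List.ofFn_succ]

theorem stripNested_n (d : ℤ) {m : ℕ} (i j : Fin m → ℕ) (c : Corners) :
    (stripNested d i j c).n = c.n := by
  induction m with
  | zero => rw [stripNested_zero]
  | succ m ih => rw [stripNested_succ]; exact ih _ _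

theorem stripNested_y_le {d : ℤ} (hd : d ≤ 1) {m : ℕ} (i j : Fin m → ℕ) (c : Corners) (p : ℕ) :
    (stripNested d i j c).y p ≤ c.y p + m := by
  induction m with
  | zero => simp [stripNested_zero]
  | succ m ih =>
    have := ih (fun r => i r.succ) (fun r => j r.succ)
    rw [stripNested_succ]
    simp only [strip]
    push_cast
    split_ifs <;> omega

theorem Strict.y_lt {c : Corners} (hc : c.Strict) {p q : ℕ} (hp : 1 ≤ p) (hpq : p < q)
    (hq : q ≤ c.n) : c.y p < c.y q := by
  induction q, hpq using Nat.le_induction with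
  | base => exact hc.y_mono p hp hq
  | succ q h ih => exact (ih (by omega)).trans (hc.y_mono q (by omega) hq)

/-- The effect of a nested family of strips on the exponents: up to a permutation, it changes the
exponents in the first rows of the strips (if they are removed) or in the rows after the strips (if
they are added). -/
theorem exists_perm_exps_stripNested {M : ℕ} {c : Corners} (hc : c.Strict) {d : ℤ} {m : ℕ}
    {i j : Fin m → ℕ} (hi : StrictMono i) (hj : StrictAnti j) (hi1 : ∀ r, 1 ≤ i r)
    (hij : ∀ r s, i r ≤ j s) (hjn : ∀ r, j r ≤ c.n) {p q : Fin m → Fin (M + 1)}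
    (hp : ∀ r, c.y (i r) = (p r : ℕ) + 1) (hq : ∀ r, c.y (j r) = (q r : ℕ))
    {u v : Fin m → Fin (M + 1)}
    (hd : (d = 1 ∧ u = q ∧ v = p) ∨ (d = -1 ∧ u = p ∧ v = q)) :
    (stripNested d i j c).Valid ∧
    (∀ t, (∀ r, t ≤ i r) → (stripNested d i j c).x t = c.x t) ∧
    (∀ t, (∀ r, t < i r) → (stripNested d i j c).y t = c.y t) ∧
    (∀ t, (∀ r, j r < t) →
      (stripNested d i j c).x t = c.x t ∧ (stripNested d i j c).y t = c.y t) ∧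
    ∃ τ : Equiv.Perm (Fin (M + 1)),
      Equiv.Perm.sign τ = ∏ r, (-1) ^ ((q r : ℕ) - p r - 1) ∧
      (∀ t, (∀ r, t < p r) → τ t = t) ∧ (∀ t, (∀ r, q r < t) → τ t = t) ∧
      (∀ r, (exps M (stripNested d i j c) (τ (u r)) : ℤ) = exps M c (v r) - d) ∧
      ∀ t, (∀ r, t ≠ u r) → exps M (stripNested d i j c) (τ t) = exps M c t := by
  induction m with
  | zero =>
    simp only [stripNested_zero]
    exact ⟨hc.valid, by simp, by simp, by simp, 1, by simp, by simp, by simp, by simp, by simp⟩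
  | succ m ih =>
    have hi0 : ∀ r : Fin m, i 0 < i r.succ := fun r => hi (Fin.succ_pos r)
    have hj0 : ∀ r : Fin m, j r.succ < j 0 := fun r => hj (Fin.succ_pos r)
    have hp0 : ∀ r : Fin m, p 0 < p r.succ := fun r => by
      have := hc.y_lt (hi1 0) (hi0 r) ((hij _ 0).trans (hjn 0))
      rw [hp, hp] at this
      rw [Fin.lt_def]
      omega
    have hq0 : ∀ r : Fin m, q r.succ < q 0 := fun r => by
      have := hc.y_lt ((hi1 0).trans (hij 0 _)) (hj0 r) (hjn 0)
      rw [hq, hq] at this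
      rw [Fin.lt_def]
      omega
    have hpq : ∀ r s, p r < q s := fun r s => by
      have := hc.valid.y_le (hi1 r) (hij r s) (hjn s)
      rw [hp, hq] at this
      rw [Fin.lt_def]
      omega
    obtain ⟨hV, hx, hy, hxy, τ₁, hs₁, hl₁, hg₁, hu₁, ho₁⟩ :=
      ih (i := fun r => i r.succ) (j := fun r => j r.succ) (p := fun r => p r.succ)
      (q := fun r => q r.succ) (u := fun r => u r.succ) (v := fun r => v r.succ)
      (fun r s h => hi (Fin.succ_lt_succ_iff.2 h)) (fun r s h => hj (Fin.succ_lt_succ_iff.2 h))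
      (fun r => hi1 _) (fun r s => hij _ _) (fun r => hjn _) (fun r => hp _) (fun r => hq _)
      (by rcases hd with ⟨rfl, rfl, rfl⟩ | ⟨rfl, rfl, rfl⟩ <;> simp)
    rw [stripNested_succ]
    have hn := stripNested_n d (fun r => i r.succ) (fun r => j r.succ) c
    set c₁ := stripNested d (fun r => i r.succ) (fun r => j r.succ) c with hc₁
    -- The inner strips act first and lie strictly between the ends of the outermost one, so the
    -- coordinates tested here still have their original values, where `Strict` applies.
    have hS : c₁.Strippable (i 0) (j 0) (p 0) (q 0) := by
      refine ⟨hi1 0, hij 0 0, by rw [hn]; exact hjn 0, ?_, ?_, ?_, ?_, ?_, ?_⟩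
      · rw [hy _ hi0, hp]
      · rw [(hxy _ hj0).2, hq]
      · intro h
        rw [hy _ fun r => by have := hi0 r; omega]
        have := hc.y_lt (p := i 0 - 1) (q := i 0) (by omega) (by omega) ((hij _ 0).trans (hjn 0))
        rw [hp] at this
        omega
      · intro h
        rw [hn] at h
        rw [(hxy _ fun r => by have := hj0 r; omega).2, ← hq]
        exact hc.y_mono _ ((hi1 0).trans (hij 0 _)) h
      · intro _
        rw [hx _ fun r => hi0 r, hx _ fun r => (hi0 r).le]
        exact hc.x_anti _ (hi1 0) ((hij _ 0).trans (hjn 0))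
      · intro _
        rw [(hxy _ fun r => by have := hj0 r; omega).1, (hxy _ hj0).1]
        exact hc.x_anti _ ((hi1 0).trans (hij 0 _)) (hjn 0)
    have hd' : (d = 1 ∧ u 0 = q 0 ∧ v 0 = p 0) ∨ (d = -1 ∧ u 0 = p 0 ∧ v 0 = q 0) := by
      rcases hd with ⟨rfl, rfl, rfl⟩ | ⟨rfl, rfl, rfl⟩ <;> simp
    -- The rows `p 0` and `q 0` lie outside the range moved by the inner permutation.
    have hu0 : τ₁ (u 0) = u 0 := by
      rcases hd with ⟨rfl, rfl, rfl⟩ | ⟨rfl, rfl, rfl⟩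
      · exact hg₁ _ hq0
      · exact hl₁ _ hp0
    have hv0 : τ₁ (v 0) = v 0 := by
      rcases hd with ⟨rfl, rfl, rfl⟩ | ⟨rfl, rfl, rfl⟩
      · exact hl₁ _ hp0
      · exact hg₁ _ hq0
    have hvu : ∀ r : Fin m, v 0 ≠ u r.succ := by
      intro r
      rcases hd with ⟨rfl, rfl, rfl⟩ | ⟨rfl, rfl, rfl⟩
      · exact (hpq _ _).ne
      · exact (hpq _ _).ne'
    have huu : ∀ r : Fin m, u r.succ ≠ u 0 := by
      intro r
      rcases hd with ⟨rfl, rfl, rfl⟩ | ⟨rfl, rfl, rfl⟩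
      · exact (hq0 r).ne
      · exact (hp0 r).ne'
    obtain ⟨τ₂, hs₂, hl₂, hg₂, hu₂, ho₂⟩ := exists_perm_exps_strip hV hS hd'
    refine ⟨valid_strip hV hS (by tauto), ?_, ?_, ?_, τ₂ * τ₁, ?_, ?_, ?_, ?_, ?_⟩
    · intro t ht
      have := ht 0
      simp only [strip]
      rw [if_neg (by omega), hx _ fun r => ht r.succ]
    · intro t ht
      have := ht 0
      simp only [strip]
      rw [if_neg (by omega), hy _ fun r => ht r.succ]
    · intro t ht
      have := ht 0
      simp only [strip]
      rw [if_neg (by omega), if_neg (by omega)]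
      exact hxy _ fun r => ht r.succ
    · rw [Equiv.Perm.sign_mul, hs₁, hs₂, Fin.prod_univ_succ]
    · intro t ht
      rw [Equiv.Perm.mul_apply, hl₁ _ fun r => ht r.succ, hl₂ _ (ht 0)]
    · intro t ht
      rw [Equiv.Perm.mul_apply, hg₁ _ fun r => ht r.succ, hg₂ _ (ht 0)]
    · intro r
      rw [Equiv.Perm.mul_apply]
      refine Fin.cases ?_ (fun r => ?_) r
      · rw [hu0, hu₂, ← ho₁ (v 0) hvu, hv0]
      · rw [ho₂, hu₁]
        intro h
        exact huu r (τ₁.injective (h.trans hu0.symm))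
    · intro t ht
      rw [Equiv.Perm.mul_apply, ho₂, ho₁ _ fun r => ht r.succ]
      intro h
      exact ht 0 (τ₁.injective (h.trans hu0.symm))

theorem rowLen_shiftColumn {c : Corners} (hc : c.Strict) {k : ℕ} (hk : 1 ≤ k) (hkn : k ≤ c.n)
    {d : ℤ} (hd : d = 1 ∨ d = -1) :
    (shiftColumn d k c).Valid ∧ ∀ t : ℕ, ((shiftColumn d k c).board.rowLen t : ℤ) =
      c.board.rowLen t + if (t : ℤ) < c.y k then d else 0 := by
  have hV : (shiftColumn d k c).Valid := by
    refine ⟨?_, ?_, hc.y_pos.le, hc.valid.y_mono⟩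
    · have := hc.x_last
      simp only [shiftColumn]
      rw [if_neg (by omega)]
      exact this
    · intro p hp hpn
      have := hc.x_anti p hp hpn
      simp only [shiftColumn]
      split_ifs <;> rcases hd with rfl | rfl <;> omega
  refine ⟨hV, fun t => ?_⟩
  obtain ⟨p, hp⟩ := c.exists_inBlock t
  have hp' : (shiftColumn d k c).InBlock p t := ⟨hp.one_le, hp.le, hp.lower, hp.upper⟩
  rw [rowLen_board hV hp', rowLen_board hc.valid hp]
  simp only [shiftColumn]
  by_cases h : (t : ℤ) < c.y k
  · have := hc.valid.inBlock_le hp hk h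
    rw [if_pos h, if_pos ⟨hp.one_le, this⟩]
  · have := hc.valid.lt_inBlock hp hkn (not_lt.1 h)
    rw [if_neg h, if_neg (by omega), add_zero]

/-- Rows `t` and `t + 1` lie in the same block. This is the source of all vanishing terms. -/
theorem rowLen_succ_of_forall_ne {c : Corners} (hc : c.Valid) {t : ℕ}
    (h : ∀ p, 1 ≤ p → p ≤ c.n → c.y p ≠ t + 1) :
    c.board.rowLen (t + 1) = c.board.rowLen t := by
  obtain ⟨p, hp⟩ := c.exists_inBlock t
  have hp' : c.InBlock p (t + 1) := by
    refine ⟨hp.one_le, hp.le, fun h1 => ?_, fun h1 => ?_⟩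
    · have := hp.lower h1
      push_cast
      omega
    · have := hp.upper h1
      have := h p hp.one_le h1
      push_cast
      omega
  zify
  rw [rowLen_board hc hp, ← rowLen_board hc hp']

theorem lt_of_mem_board {c : Corners} {K : ℕ} (hc : ∀ p, 1 ≤ p → p ≤ c.n → c.y p ≤ K) :
    ∀ a ∈ c.board.cells, a.1 < K := by
  rintro ⟨a, b⟩ h
  obtain ⟨p, ⟨h1, h2⟩, h3, _⟩ := mem_board.1 ((YoungDiagram.mem_cells _).1 h)
  have := hc p h1 h2
  simp only
  omega

end Corners

/-! ### Exchange permutations and index tuples. -/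

/-- The product of the `m` disjoint transpositions of `p r` and `q r`. -/
theorem Equiv.Perm.exists_exchange {α : Type*} [Fintype α] [DecidableEq α] {m : ℕ}
    {p q : Fin m → α} (hp : Function.Injective p) (hq : Function.Injective q)
    (hpq : ∀ r s, p r ≠ q s) :
    ∃ σ : Equiv.Perm α, Equiv.Perm.sign σ = (-1) ^ m ∧ (∀ r, σ (p r) = q r) ∧
      (∀ r, σ (q r) = p r) ∧ ∀ t, (∀ r, t ≠ p r) → (∀ r, t ≠ q r) → σ t = t := by
  induction m with
  | zero => exact ⟨1, by simp, by simp, by simp, by simp⟩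
  | succ m ih =>
    obtain ⟨σ, hs, h1, h2, h3⟩ := ih (p := fun r => p r.succ) (q := fun r => q r.succ)
      (hp.comp (Fin.succ_injective m)) (hq.comp (Fin.succ_injective m)) (fun r s => hpq _ _)
    have hp0 : ∀ r : Fin m, p r.succ ≠ p 0 := fun r h => Fin.succ_ne_zero r (hp h)
    have hq0 : ∀ r : Fin m, q r.succ ≠ q 0 := fun r h => Fin.succ_ne_zero r (hq h)
    refine ⟨Equiv.swap (p 0) (q 0) * σ, ?_, fun r => ?_, fun r => ?_, fun t ht ht' => ?_⟩
    · rw [Equiv.Perm.sign_mul, Equiv.Perm.sign_swap (hpq 0 0), hs, pow_succ']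
    · rw [Equiv.Perm.mul_apply]
      refine Fin.cases ?_ (fun r => ?_) r
      · rw [h3 _ (fun r => (hp0 r).symm) (fun r => hpq _ _), Equiv.swap_apply_left]
      · rw [h1, Equiv.swap_apply_of_ne_of_ne (hpq _ _).symm (hq0 r)]
    · rw [Equiv.Perm.mul_apply]
      refine Fin.cases ?_ (fun r => ?_) r
      · rw [h3 _ (fun r => (hpq _ _).symm) (fun r => (hq0 r).symm), Equiv.swap_apply_right]
      · rw [h2, Equiv.swap_apply_of_ne_of_ne (hp0 r) (hpq _ _)]
    · rw [Equiv.Perm.mul_apply, h3 _ (fun r => ht _) (fun r => ht' _),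
        Equiv.swap_apply_of_ne_of_ne (ht 0) (ht' 0)]

theorem Equiv.Perm.exists_mem_iff_of_card_eq {α : Type*} [Fintype α] [DecidableEq α]
    {I J : Finset α} (h : J.card = I.card) : ∃ σ : Equiv.Perm α, ∀ t, σ t ∈ I ↔ t ∈ J := by
  have e : {x // x ∈ J} ≃ {x // x ∈ I} := Finset.equivOfCardEq h
  refine ⟨e.extendSubtype, fun t => ⟨fun ht => ?_, fun ht => e.extendSubtype_mem t ht⟩⟩
  by_contra ht'
  exact e.extendSubtype_not_mem t ht' ht

theorem mem_nestedIndices {n k m : ℕ} {q : (Fin m → ℕ) × (Fin m → ℕ)} :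
    q ∈ nestedIndices n k m ↔ (∀ r, 1 ≤ q.1 r ∧ q.1 r ≤ k) ∧ (∀ r, k ≤ q.2 r ∧ q.2 r ≤ n) ∧
      StrictMono q.1 ∧ StrictAnti q.2 := by
  simp only [nestedIndices, Finset.mem_filter, Finset.mem_product, Fintype.mem_piFinset,
    Finset.mem_Icc, and_assoc]
  rfl

theorem le_of_mem_nestedIndices {n k m : ℕ} {q : (Fin m → ℕ) × (Fin m → ℕ)}
    (hq : q ∈ nestedIndices n k m) : m ≤ k := by
  rw [mem_nestedIndices] at hq
  have h : (Finset.univ.image q.1).card ≤ (Finset.Icc 1 k).card := by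
    refine Finset.card_le_card fun x hx => ?_
    obtain ⟨r, _, rfl⟩ := Finset.mem_image.1 hx
    exact Finset.mem_Icc.2 (hq.1 r)
  rw [Finset.card_image_of_injective _ hq.2.2.1.injective] at h
  simpa using h

/-! ### Nested indices correspond to exchangeable sets of rows. -/

namespace Corners

/-- The last row of block `p`. -/
def bottom (M : ℕ) (c : Corners) (p : ℕ) : Fin (M + 1) := Fin.ofNat (M + 1) (c.y p - 1).toNat

/-- The first row of block `p + 1`. -/
def top (M : ℕ) (c : Corners) (p : ℕ) : Fin (M + 1) := Fin.ofNat (M + 1) (c.y p).toNat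

section Bijection

variable {M : ℕ} {c : Corners} {k : ℕ}

theorem Strict.y_pos' (hc : c.Strict) {p : ℕ} (hp : 1 ≤ p) (hpn : p ≤ c.n) : 0 < c.y p :=
  hc.y_pos.trans_le (hc.valid.y_le le_rfl hp hpn)

/-- The bound `hM` makes the reduction modulo `M + 1` in `bottom` harmless. -/
theorem y_eq_bottom (hc : c.Strict) (hM : c.y c.n ≤ M) {p : ℕ} (hp : 1 ≤ p) (hpn : p ≤ c.n) :
    c.y p = (bottom M c p : ℕ) + 1 := by
  have h1 := hc.y_pos' hp hpn
  have h2 := hc.valid.y_le hp hpn le_rfl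
  rw [bottom, Fin.val_ofNat, Nat.mod_eq_of_lt (by omega)]
  omega

theorem y_eq_top (hc : c.Strict) (hM : c.y c.n ≤ M) {p : ℕ} (hp : 1 ≤ p) (hpn : p ≤ c.n) :
    c.y p = (top M c p : ℕ) := by
  have h1 := hc.y_pos' hp hpn
  have h2 := hc.valid.y_le hp hpn le_rfl
  rw [top, Fin.val_ofNat, Nat.mod_eq_of_lt (by omega)]
  omega

theorem Strict.y_injOn (hc : c.Strict) {p q : ℕ} (hp : 1 ≤ p) (hpn : p ≤ c.n) (hq : 1 ≤ q)
    (hqn : q ≤ c.n) (h : c.y p = c.y q) : p = q := by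
  rcases lt_trichotomy p q with h1 | h1 | h1
  · exact absurd h (hc.y_lt hp h1 hqn).ne
  · exact h1
  · exact absurd h (hc.y_lt hq h1 hpn).ne'

theorem bottom_injOn (hc : c.Strict) (hM : c.y c.n ≤ M) {p q : ℕ} (hp : 1 ≤ p) (hpn : p ≤ c.n)
    (hq : 1 ≤ q) (hqn : q ≤ c.n) (h : bottom M c p = bottom M c q) : p = q :=
  hc.y_injOn hp hpn hq hqn (by rw [y_eq_bottom hc hM hp hpn, y_eq_bottom hc hM hq hqn, h])

theorem top_injOn (hc : c.Strict) (hM : c.y c.n ≤ M) {p q : ℕ} (hp : 1 ≤ p) (hpn : p ≤ c.n)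
    (hq : 1 ≤ q) (hqn : q ≤ c.n) (h : top M c p = top M c q) : p = q :=
  hc.y_injOn hp hpn hq hqn (by rw [y_eq_top hc hM hp hpn, y_eq_top hc hM hq hqn, h])

/-- The rows of the first `k` blocks. -/
def upperRows (M : ℕ) (c : Corners) (k : ℕ) : Finset (Fin (M + 1)) :=
  Finset.univ.filter fun t => (t : ℤ) < c.y k

/-- The rows of the first `k` blocks, with some last rows of blocks replaced by first rows of
later blocks. -/
def exchanged (M : ℕ) (c : Corners) (k : ℕ) {m : ℕ} (i j : Fin m → ℕ) : Finset (Fin (M + 1)) :=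
  (upperRows M c k \ Finset.univ.image fun r => bottom M c (i r)) ∪
    Finset.univ.image fun r => top M c (j r)

theorem mem_upperRows {t : Fin (M + 1)} : t ∈ upperRows M c k ↔ (t : ℤ) < c.y k := by
  simp [upperRows]

theorem mem_exchanged {m : ℕ} {i j : Fin m → ℕ} {t : Fin (M + 1)} :
    t ∈ exchanged M c k i j ↔
      ((t : ℤ) < c.y k ∧ ∀ r, t ≠ bottom M c (i r)) ∨ ∃ r, t = top M c (j r) := by
  simp [exchanged, mem_upperRows, eq_comm]

/-- The sets of rows obtained by exchanging only last rows of blocks with first rows of blocks. -/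
structure Exchangeable (M : ℕ) (c : Corners) (k : ℕ) (J : Finset (Fin (M + 1))) : Prop where
  card_eq : J.card = (upperRows M c k).card
  bottom : ∀ t ∈ upperRows M c k, t ∉ J → ∃ p, 1 ≤ p ∧ p ≤ k ∧ t = bottom M c p
  top : ∀ t ∈ J, t ∉ upperRows M c k → ∃ p, k ≤ p ∧ p ≤ c.n ∧ t = top M c p

theorem bottom_mem_upperRows (hc : c.Strict) (hM : c.y c.n ≤ M) (hkn : k ≤ c.n) {p : ℕ}
    (hp : 1 ≤ p) (hpk : p ≤ k) :
    bottom M c p ∈ upperRows M c k := by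
  rw [mem_upperRows]
  have h1 := y_eq_bottom hc hM hp (hpk.trans hkn)
  have h2 := hc.valid.y_le hp hpk hkn
  omega

theorem top_notMem_upperRows (hc : c.Strict) (hM : c.y c.n ≤ M) (hk : 1 ≤ k) {p : ℕ}
    (hp : k ≤ p) (hpn : p ≤ c.n) :
    top M c p ∉ upperRows M c k := by
  rw [mem_upperRows]
  have h1 := y_eq_top hc hM (hk.trans hp) hpn
  have h2 := hc.valid.y_le hk hp hpn
  omega

theorem bottom_comp_injective (hc : c.Strict) (hM : c.y c.n ≤ M) (hkn : k ≤ c.n) {m : ℕ}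
    {q : (Fin m → ℕ) × (Fin m → ℕ)}
    (hq : q ∈ nestedIndices c.n k m) : Function.Injective fun r => bottom M c (q.1 r) := by
  rw [mem_nestedIndices] at hq
  exact fun r s h => hq.2.2.1.injective (bottom_injOn hc hM (hq.1 r).1 ((hq.1 r).2.trans hkn)
    (hq.1 s).1 ((hq.1 s).2.trans hkn) h)

theorem top_comp_injective (hc : c.Strict) (hM : c.y c.n ≤ M) (hk : 1 ≤ k) {m : ℕ}
    {q : (Fin m → ℕ) × (Fin m → ℕ)}
    (hq : q ∈ nestedIndices c.n k m) : Function.Injective fun r => top M c (q.2 r) := by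
  rw [mem_nestedIndices] at hq
  exact fun r s h => hq.2.2.2.injective (top_injOn hc hM (hk.trans (hq.2.1 r).1) (hq.2.1 r).2
    (hk.trans (hq.2.1 s).1) (hq.2.1 s).2 h)

theorem exchanged_sdiff_upperRows (hc : c.Strict) (hM : c.y c.n ≤ M) (hk : 1 ≤ k) {m : ℕ}
    {q : (Fin m → ℕ) × (Fin m → ℕ)}
    (hq : q ∈ nestedIndices c.n k m) :
    exchanged M c k q.1 q.2 \ upperRows M c k = Finset.univ.image fun r => top M c (q.2 r) := by
  rw [mem_nestedIndices] at hq
  ext t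
  rw [Finset.mem_sdiff, mem_exchanged, ← mem_upperRows (M := M), Finset.mem_image]
  constructor
  · rintro ⟨⟨h1, _⟩ | ⟨r, h1⟩, h2⟩
    · exact absurd h1 h2
    · exact ⟨r, Finset.mem_univ _, h1.symm⟩
  · rintro ⟨r, _, rfl⟩
    exact ⟨Or.inr ⟨r, rfl⟩, top_notMem_upperRows hc hM hk (hq.2.1 r).1 (hq.2.1 r).2⟩

variable (hc : c.Strict) (hM : c.y c.n ≤ M) (hk : 1 ≤ k) (hkn : k ≤ c.n)
include hc hM hk hkn

theorem upperRows_sdiff_exchanged {m : ℕ} {q : (Fin m → ℕ) × (Fin m → ℕ)}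
    (hq : q ∈ nestedIndices c.n k m) :
    upperRows M c k \ exchanged M c k q.1 q.2 = Finset.univ.image fun r => bottom M c (q.1 r) := by
  rw [mem_nestedIndices] at hq
  ext t
  rw [Finset.mem_sdiff, mem_exchanged, ← mem_upperRows (M := M), Finset.mem_image]
  constructor
  · rintro ⟨h1, h2⟩
    by_contra! h3
    exact h2 (Or.inl ⟨h1, fun r hr => h3 r (Finset.mem_univ _) hr.symm⟩)
  · rintro ⟨r, _, rfl⟩
    have h1 := bottom_mem_upperRows hc hM hkn (hq.1 r).1 (hq.1 r).2
    refine ⟨h1, ?_⟩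
    rintro (⟨_, h⟩ | ⟨s, h⟩)
    · exact h r rfl
    · exact top_notMem_upperRows hc hM hk (hq.2.1 s).1 (hq.2.1 s).2 (h ▸ h1)

theorem card_upperRows_sdiff_exchanged {m : ℕ} {q : (Fin m → ℕ) × (Fin m → ℕ)}
    (hq : q ∈ nestedIndices c.n k m) :
    (upperRows M c k \ exchanged M c k q.1 q.2).card = m := by
  rw [upperRows_sdiff_exchanged hc hM hk hkn hq,
    Finset.card_image_of_injective _ (bottom_comp_injective hc hM hkn hq)]
  simp

theorem exchangeable_exchanged {m : ℕ} {q : (Fin m → ℕ) × (Fin m → ℕ)}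
    (hq : q ∈ nestedIndices c.n k m) : Exchangeable M c k (exchanged M c k q.1 q.2) := by
  have h1 := upperRows_sdiff_exchanged hc hM hk hkn hq
  have h2 := exchanged_sdiff_upperRows hc hM hk hq
  have hq' := mem_nestedIndices.1 hq
  refine ⟨?_, fun t ht ht' => ?_, fun t ht ht' => ?_⟩
  · apply le_antisymm
    · rw [← Finset.card_sdiff_le_card_sdiff_iff, h2,
        card_upperRows_sdiff_exchanged hc hM hk hkn hq]
      exact Finset.card_image_le.trans (by simp)
    · rw [← Finset.card_sdiff_le_card_sdiff_iff, h2,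
        card_upperRows_sdiff_exchanged hc hM hk hkn hq,
        Finset.card_image_of_injective _ (top_comp_injective hc hM hk hq)]
      simp
  · have h := h1 ▸ Finset.mem_sdiff.2 ⟨ht, ht'⟩
    obtain ⟨r, _, rfl⟩ := Finset.mem_image.1 h
    exact ⟨_, (hq'.1 r).1, (hq'.1 r).2, rfl⟩
  · have h := h2 ▸ Finset.mem_sdiff.2 ⟨ht, ht'⟩
    obtain ⟨r, _, rfl⟩ := Finset.mem_image.1 h
    exact ⟨_, (hq'.2.1 r).1, (hq'.2.1 r).2, rfl⟩

/-- The two set differences with `upperRows` recover the ranges of both tuples, and a strictly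
monotone tuple is determined by its range. -/
theorem exchanged_injOn {m : ℕ} {q q' : (Fin m → ℕ) × (Fin m → ℕ)}
    (hq : q ∈ nestedIndices c.n k m) (hq' : q' ∈ nestedIndices c.n k m)
    (h : exchanged M c k q.1 q.2 = exchanged M c k q'.1 q'.2) : q = q' := by
  have h1 := upperRows_sdiff_exchanged hc hM hk hkn hq
  have h2 := exchanged_sdiff_upperRows hc hM hk hq
  rw [h, upperRows_sdiff_exchanged hc hM hk hkn hq'] at h1
  rw [h, exchanged_sdiff_upperRows hc hM hk hq'] at h2
  have hq := mem_nestedIndices.1 hq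
  have hq' := mem_nestedIndices.1 hq'
  refine Prod.ext ?_ ?_
  · refine (hq.2.2.1.range_inj hq'.2.2.1).1 (Set.ext fun x => ⟨?_, ?_⟩)
    · rintro ⟨r, rfl⟩
      obtain ⟨s, _, hs⟩ := Finset.mem_image.1
        (h1 ▸ Finset.mem_image_of_mem (fun r => bottom M c (q.1 r)) (Finset.mem_univ r))
      exact ⟨s, bottom_injOn hc hM (hq'.1 s).1 ((hq'.1 s).2.trans hkn) (hq.1 r).1
        ((hq.1 r).2.trans hkn) hs⟩
    · rintro ⟨r, rfl⟩
      obtain ⟨s, _, hs⟩ := Finset.mem_image.1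
        (h1 ▸ Finset.mem_image_of_mem (fun r => bottom M c (q'.1 r)) (Finset.mem_univ r))
      exact ⟨s, bottom_injOn hc hM (hq.1 s).1 ((hq.1 s).2.trans hkn) (hq'.1 r).1
        ((hq'.1 r).2.trans hkn) hs⟩
  · have ha : StrictMono fun r : Fin m => q.2 r.rev := fun r s h => hq.2.2.2 (Fin.rev_lt_rev.2 h)
    have ha' : StrictMono fun r : Fin m => q'.2 r.rev :=
      fun r s h => hq'.2.2.2 (Fin.rev_lt_rev.2 h)
    have h3 : (fun r : Fin m => q.2 r.rev) = fun r : Fin m => q'.2 r.rev := by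
      refine (ha.range_inj ha').1 (Set.ext fun x => ⟨?_, ?_⟩)
      · rintro ⟨r, rfl⟩
        obtain ⟨s, _, hs⟩ := Finset.mem_image.1
          (h2 ▸ Finset.mem_image_of_mem (fun r => top M c (q.2 r)) (Finset.mem_univ r.rev))
        refine ⟨s.rev, ?_⟩
        simp only [Fin.rev_rev]
        exact top_injOn hc hM (hk.trans (hq'.2.1 s).1) (hq'.2.1 s).2
          (hk.trans (hq.2.1 _).1) (hq.2.1 _).2 hs
      · rintro ⟨r, rfl⟩
        obtain ⟨s, _, hs⟩ := Finset.mem_image.1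
          (h2 ▸ Finset.mem_image_of_mem (fun r => top M c (q'.2 r)) (Finset.mem_univ r.rev))
        refine ⟨s.rev, ?_⟩
        simp only [Fin.rev_rev]
        exact top_injOn hc hM (hk.trans (hq.2.1 s).1) (hq.2.1 s).2
          (hk.trans (hq'.2.1 _).1) (hq'.2.1 _).2 hs
    funext r
    have := congrFun h3 r.rev
    simpa using this

/-- Enumerate the blocks whose last row is removed in increasing order and those whose following row
is added in decreasing order. Equal cardinality of `J` and `upperRows` makes both lists have length
`m`. -/
theorem exists_exchanged_eq {J : Finset (Fin (M + 1))} (hJ : Exchangeable M c k J) {m : ℕ}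
    (hm : (upperRows M c k \ J).card = m) :
    ∃ q ∈ nestedIndices c.n k m, exchanged M c k q.1 q.2 = J := by
  set X : Finset ℕ := (Finset.Icc 1 k).filter fun p => bottom M c p ∉ J with hX
  set Y : Finset ℕ := (Finset.Icc k c.n).filter fun p => top M c p ∈ J with hY
  have hXi : X.image (bottom M c) = upperRows M c k \ J := by
    ext t
    simp only [hX, Finset.mem_image, Finset.mem_filter, Finset.mem_Icc, Finset.mem_sdiff]
    constructor
    · rintro ⟨p, ⟨⟨h1, h2⟩, h3⟩, rfl⟩
      exact ⟨bottom_mem_upperRows hc hM hkn h1 h2, h3⟩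
    · rintro ⟨h1, h2⟩
      obtain ⟨p, h3, h4, rfl⟩ := hJ.bottom t h1 h2
      exact ⟨p, ⟨⟨h3, h4⟩, h2⟩, rfl⟩
  have hYi : Y.image (top M c) = J \ upperRows M c k := by
    ext t
    simp only [hY, Finset.mem_image, Finset.mem_filter, Finset.mem_Icc, Finset.mem_sdiff]
    constructor
    · rintro ⟨p, ⟨⟨h1, h2⟩, h3⟩, rfl⟩
      exact ⟨h3, top_notMem_upperRows hc hM hk h1 h2⟩
    · rintro ⟨h1, h2⟩
      obtain ⟨p, h3, h4, rfl⟩ := hJ.top t h1 h2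
      exact ⟨p, ⟨⟨h3, h4⟩, h1⟩, rfl⟩
  have hXm : X.card = m := by
    rw [← hm, ← hXi, Finset.card_image_of_injOn]
    intro p hp p' hp' h
    simp only [hX, Finset.coe_filter, Finset.mem_Icc, Set.mem_ofPred_eq] at hp hp'
    exact bottom_injOn hc hM (by omega) (by omega) (by omega) (by omega) h
  have hYm : Y.card = m := by
    rw [← hm, ← Finset.card_sdiff_comm hJ.card_eq, ← hYi, Finset.card_image_of_injOn]
    intro p hp p' hp' h
    simp only [hY, Finset.coe_filter, Finset.mem_Icc, Set.mem_ofPred_eq] at hp hp'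
    exact top_injOn hc hM (by omega) (by omega) (by omega) (by omega) h
  have hXr : ∀ r, X.orderEmbOfFin hXm r ∈ X := fun r => Finset.orderEmbOfFin_mem X hXm r
  have hYr : ∀ r, Y.orderEmbOfFin hYm r ∈ Y := fun r => Finset.orderEmbOfFin_mem Y hYm r
  refine ⟨(fun r => X.orderEmbOfFin hXm r, fun r => Y.orderEmbOfFin hYm r.rev), ?_, ?_⟩
  · rw [mem_nestedIndices]
    refine ⟨fun r => ?_, fun r => ?_, fun r s h => (X.orderEmbOfFin hXm).strictMono h,
      fun r s h => (Y.orderEmbOfFin hYm).strictMono (Fin.rev_lt_rev.2 h)⟩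
    · exact Finset.mem_Icc.1 (Finset.mem_filter.1 (hXr r)).1
    · exact Finset.mem_Icc.1 (Finset.mem_filter.1 (hYr r.rev)).1
  · have e1 : (Finset.univ.image fun r => bottom M c (X.orderEmbOfFin hXm r)) =
        upperRows M c k \ J := by
      refine Eq.trans ?_
        ((congrArg (Finset.image _) (Finset.image_orderEmbOfFin_univ X hXm)).trans hXi)
      rw [Finset.image_image]
      rfl
    have e2 : (Finset.univ.image fun r : Fin m => top M c (Y.orderEmbOfFin hYm r.rev)) =
        J \ upperRows M c k := by
      refine Eq.trans ?_
        ((congrArg (Finset.image _) (Finset.image_orderEmbOfFin_univ Y hYm)).trans hYi)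
      rw [Finset.image_image]
      ext t
      simp only [Finset.mem_image, Finset.mem_univ, true_and]
      exact ⟨fun ⟨r, h⟩ => ⟨r.rev, h⟩, fun ⟨r, h⟩ => ⟨r.rev, by simpa using h⟩⟩
    rw [exchanged, e1, e2]
    ext t
    simp only [Finset.mem_union, Finset.mem_sdiff]
    tauto

end Bijection

end Corners

/-! ### The terms of the Plücker relation. -/

namespace Corners

section Alternants

variable {R : Type*} [CommRing R] {M : ℕ} {c : Corners} {k : ℕ}

theorem alternant_exps (z : ℕ → R) (hM : ∀ p, 1 ≤ p → p ≤ c.n → c.y p ≤ (M + 1 : ℕ)) :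
    alternant (exps M c) z = vandermondeProd z (M + 1) * tableauSum (M + 1) c.board z :=
  (vandermondeProd_mul_tableauSum z (M + 1) c.board (lt_of_mem_board hM)).symm

theorem alternant_addOmega (hc : c.Strict) (hM : c.y c.n ≤ M) (hk : 1 ≤ k) (hkn : k ≤ c.n)
    (z : ℕ → R) :
    alternant (fun t => if t ∈ upperRows M c k then exps M c t + 1 else exps M c t) z =
      vandermondeProd z (M + 1) * tableauSum (M + 1) (c.addOmega k).board z := by
  rw [← alternant_exps]
  · congr 1
    funext t
    have := (rowLen_shiftColumn hc hk hkn (Or.inl rfl)).2 t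
    simp only [mem_upperRows, exps, addOmega]
    split_ifs at this ⊢ <;> omega
  · intro p hp hpn
    have := hc.valid.y_le hp (show p ≤ c.n from hpn) le_rfl
    simp only [addOmega, shiftColumn]
    push_cast
    omega

/-- Raising all exponents by one makes this family complementary to that of `alternant_addOmega`:
exchanging the columns in `upperRows` yields `exps` and `exps + 1` throughout. -/
theorem alternant_subOmega (hc : c.Strict) (hM : c.y c.n ≤ M) (hk : 1 ≤ k) (hkn : k ≤ c.n)
    (z : ℕ → R) :
    alternant (fun t => if t ∈ upperRows M c k then exps M c t else exps M c t + 1) z =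
      (∏ i : Fin (M + 1), z i) *
        (vandermondeProd z (M + 1) * tableauSum (M + 1) (c.subOmega k).board z) := by
  rw [← alternant_exps, ← alternant_add_one]
  · congr 1
    funext t
    have := (rowLen_shiftColumn hc hk hkn (Or.inr rfl)).2 t
    simp only [mem_upperRows, exps, subOmega]
    split_ifs at this ⊢ <;> omega
  · intro p hp hpn
    have := hc.valid.y_le hp (show p ≤ c.n from hpn) le_rfl
    simp only [subOmega, shiftColumn]
    push_cast
    omega

theorem exps_succ_of_forall_ne (hc : c.Valid) {t t' : Fin (M + 1)} (ht : (t' : ℕ) = t + 1)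
    (h : ∀ p, 1 ≤ p → p ≤ c.n → c.y p ≠ (t : ℕ) + 1) : exps M c t = exps M c t' + 1 := by
  have h1 := rowLen_succ_of_forall_ne hc h
  have := t'.2
  rw [exps, exps, ht, h1]
  omega

variable (hc : c.Strict) (hM : c.y c.n + c.n ≤ M) (hk : 1 ≤ k) (hkn : k ≤ c.n)
include hc hM hk hkn

/-- A removed row that is not the last of its block gives equal columns in the second factor, paired
with the row below; an added row that is not the first of its block gives equal columns in the first
factor, paired with the row above. -/
theorem alternant_mul_alternant_eq_zero (z : ℕ → R) {J : Finset (Fin (M + 1))}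
    (hJc : J.card = (upperRows M c k).card) (hJ : ¬ Exchangeable M c k J)
    {σ : Equiv.Perm (Fin (M + 1))} (hσ : ∀ t, σ t ∈ upperRows M c k ↔ t ∈ J) :
    alternant (fun t => if t ∈ upperRows M c k then
        (if σ.symm t ∈ upperRows M c k then exps M c (σ.symm t) else exps M c (σ.symm t) + 1)
        else (if t ∈ upperRows M c k then exps M c t + 1 else exps M c t)) z *
      alternant (fun t => if t ∈ J then
        (if σ t ∈ upperRows M c k then exps M c (σ t) + 1 else exps M c (σ t))
        else (if t ∈ upperRows M c k then exps M c t else exps M c t + 1)) z = 0 := by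
  have hM' : c.y c.n ≤ M := by omega
  have hcases : (∃ t ∈ upperRows M c k, t ∉ J ∧ ∀ p, 1 ≤ p → p ≤ k → t ≠ bottom M c p) ∨
      ∃ t ∈ J, t ∉ upperRows M c k ∧ ∀ p, k ≤ p → p ≤ c.n → t ≠ top M c p := by
    by_contra! h
    exact hJ ⟨hJc, h.1, h.2⟩
  rcases hcases with ⟨t, ht, htJ, hb⟩ | ⟨t, htJ, ht, hb⟩
  · have ht' := mem_upperRows.1 ht
    have hne : ∀ p, 1 ≤ p → p ≤ c.n → c.y p ≠ (t : ℕ) + 1 := by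
      intro p hp hpn h
      have h1 := y_eq_bottom hc hM' hp hpn
      by_cases hpk : p ≤ k
      · exact hb p hp hpk (Fin.ext (by omega))
      · have := hc.y_lt hk (not_le.1 hpk) hpn
        omega
    have h1 := hne k hk hkn
    have h2 := hc.valid.y_le hk hkn le_rfl
    set s : Fin (M + 1) := ⟨t + 1, by omega⟩ with hs
    have hsI : s ∈ upperRows M c k := by
      rw [mem_upperRows]
      simp only [hs]
      push_cast
      omega
    have hsJ : σ.symm s ∈ J := by rw [← hσ]; simpa using hsI
    have he := exps_succ_of_forall_ne hc.valid (t := t) (t' := s) rfl hne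
    rw [alternant_eq_zero (f := fun t => if t ∈ J then
        (if σ t ∈ upperRows M c k then exps M c (σ t) + 1 else exps M c (σ t))
        else (if t ∈ upperRows M c k then exps M c t else exps M c t + 1)) z (i := t)
      (j := σ.symm s) (fun h => htJ (h ▸ hsJ)), mul_zero]
    simp [htJ, ht, hsJ, hsI, he]
  · have ht' := mem_upperRows.not.1 ht
    have h0 := y_eq_top hc hM' hk hkn
    have h1 : t ≠ top M c k := hb k le_rfl hkn
    have h2 : (t : ℕ) ≠ top M c k := fun h => h1 (Fin.ext h)
    have hp := hc.y_pos' hk hkn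
    set s : Fin (M + 1) := ⟨t - 1, by omega⟩ with hs
    have hst : (t : ℕ) = s + 1 := by simp only [hs]; omega
    have hne : ∀ p, 1 ≤ p → p ≤ c.n → c.y p ≠ (s : ℕ) + 1 := by
      intro p hp hpn h
      have h3 := y_eq_top hc hM' hp hpn
      by_cases hpk : k ≤ p
      · exact hb p hpk hpn (Fin.ext (by omega))
      · have := hc.y_lt hp (not_le.1 hpk) hkn
        omega
    have hsI : s ∉ upperRows M c k := by
      rw [mem_upperRows]
      omega
    have htI : σ t ∈ upperRows M c k := (hσ t).2 htJ
    have he := exps_succ_of_forall_ne hc.valid hst hne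
    rw [alternant_eq_zero (f := fun t => if t ∈ upperRows M c k then
        (if σ.symm t ∈ upperRows M c k then exps M c (σ.symm t) else exps M c (σ.symm t) + 1)
        else (if t ∈ upperRows M c k then exps M c t + 1 else exps M c t)) z (i := σ t)
      (j := s) (fun h => hsI (h ▸ htI)), zero_mul]
    simp [ht, htI, hsI, he]

theorem alternant_mul_alternant_exchanged (z : ℕ → R) {m : ℕ}
    {q : (Fin m → ℕ) × (Fin m → ℕ)} (hq : q ∈ nestedIndices c.n k m)
    {σ : Equiv.Perm (Fin (M + 1))} (hs : Equiv.Perm.sign σ = (-1) ^ m)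
    (hb : ∀ r, σ (bottom M c (q.1 r)) = top M c (q.2 r))
    (ht : ∀ r, σ (top M c (q.2 r)) = bottom M c (q.1 r))
    (ho : ∀ t, (∀ r, t ≠ bottom M c (q.1 r)) → (∀ r, t ≠ top M c (q.2 r)) → σ t = t) :
    alternant (fun t => if t ∈ upperRows M c k then
        (if σ.symm t ∈ upperRows M c k then exps M c (σ.symm t) else exps M c (σ.symm t) + 1)
        else (if t ∈ upperRows M c k then exps M c t + 1 else exps M c t)) z *
      alternant (fun t => if t ∈ exchanged M c k q.1 q.2 then
        (if σ t ∈ upperRows M c k then exps M c (σ t) + 1 else exps M c (σ t))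
        else (if t ∈ upperRows M c k then exps M c t else exps M c t + 1)) z =
      (∏ i : Fin (M + 1), z i) * vandermondeProd z (M + 1) ^ 2 * ((-1) ^ m *
        (tableauSum (M + 1) (piNested q.1 q.2 c).board z *
          tableauSum (M + 1) (muNested q.1 q.2 c).board z)) := by
  have hM' : c.y c.n ≤ M := by omega
  have hq' := mem_nestedIndices.1 hq
  have hmn : m ≤ c.n := (le_of_mem_nestedIndices hq).trans hkn
  have hbI : ∀ r, bottom M c (q.1 r) ∈ upperRows M c k := fun r =>
    bottom_mem_upperRows hc hM' hkn (hq'.1 r).1 (hq'.1 r).2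
  have htI : ∀ r, top M c (q.2 r) ∉ upperRows M c k := fun r =>
    top_notMem_upperRows hc hM' hk (hq'.2.1 r).1 (hq'.2.1 r).2
  have hbt : ∀ r s, bottom M c (q.1 r) ≠ top M c (q.2 s) := fun r s h => htI s (h ▸ hbI r)
  have hyb : ∀ r, c.y (q.1 r) = (bottom M c (q.1 r) : ℕ) + 1 := fun r =>
    y_eq_bottom hc hM' (hq'.1 r).1 ((hq'.1 r).2.trans hkn)
  have hyt : ∀ r, c.y (q.2 r) = (top M c (q.2 r) : ℕ) := fun r =>
    y_eq_top hc hM' (hk.trans (hq'.2.1 r).1) (hq'.2.1 r).2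
  have hle : ∀ {d : ℤ}, d ≤ 1 → ∀ p, 1 ≤ p → p ≤ (stripNested d q.1 q.2 c).n →
      (stripNested d q.1 q.2 c).y p ≤ (M + 1 : ℕ) := by
    intro d hd p hp hpn
    rw [stripNested_n] at hpn
    have h1 := stripNested_y_le hd q.1 q.2 c p
    have h2 := hc.valid.y_le hp hpn le_rfl
    push_cast
    omega
  obtain ⟨-, -, -, -, τ, hτs, -, -, hτu, hτo⟩ := exists_perm_exps_stripNested hc hq'.2.2.1
    hq'.2.2.2 (fun r => (hq'.1 r).1) (fun r s => (hq'.1 r).2.trans (hq'.2.1 s).1)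
    (fun r => (hq'.2.1 r).2) hyb hyt (d := 1) (Or.inl ⟨rfl, rfl, rfl⟩)
  obtain ⟨-, -, -, -, ρ, hρs, -, -, hρu, hρo⟩ := exists_perm_exps_stripNested hc hq'.2.2.1
    hq'.2.2.2 (fun r => (hq'.1 r).1) (fun r s => (hq'.1 r).2.trans (hq'.2.1 s).1)
    (fun r => (hq'.2.1 r).2) hyb hyt (d := -1) (Or.inr ⟨rfl, rfl, rfl⟩)
  -- At a last row of a block, `σ⁻¹` fetches the exponent of the matching first row plus one, as
  -- removal of the strip requires.
  have e1 : (fun t => if t ∈ upperRows M c k then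
        (if σ.symm t ∈ upperRows M c k then exps M c (σ.symm t) else exps M c (σ.symm t) + 1)
        else (if t ∈ upperRows M c k then exps M c t + 1 else exps M c t)) =
      exps M (stripNested (-1) q.1 q.2 c) ∘ ρ := by
    funext t
    rw [Function.comp_apply]
    by_cases h1 : ∃ r, t = bottom M c (q.1 r)
    · obtain ⟨r, rfl⟩ := h1
      have h2 : σ.symm (bottom M c (q.1 r)) = top M c (q.2 r) := by
        rw [Equiv.symm_apply_eq, ht]
      have h3 := hρu r
      rw [if_pos (hbI r), h2, if_neg (htI r)]
      omega
    · push Not at h1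
      rw [hρo t h1]
      by_cases h2 : t ∈ upperRows M c k
      · have h3 : σ.symm t = t := by
          rw [Equiv.symm_apply_eq, ho t h1 fun r h => htI r (h ▸ h2)]
        rw [if_pos h2, h3, if_pos h2]
      · rw [if_neg h2, if_neg h2]
  -- The second factor has the raised exponents of `π(λ)`, but with the columns of the paired rows
  -- swapped; the extra `σ` yields the sign `(-1) ^ m`.
  have e2 : (fun t => if t ∈ exchanged M c k q.1 q.2 then
        (if σ t ∈ upperRows M c k then exps M c (σ t) + 1 else exps M c (σ t))
        else (if t ∈ upperRows M c k then exps M c t else exps M c t + 1)) =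
      (fun t => (exps M (stripNested 1 q.1 q.2 c) ∘ τ) t + 1) ∘ σ := by
    funext t
    rw [Function.comp_apply, Function.comp_apply]
    have hme := mem_exchanged (M := M) (c := c) (k := k) (i := q.1) (j := q.2) (t := t)
    rw [← mem_upperRows (M := M)] at hme
    by_cases h1 : ∃ r, t = bottom M c (q.1 r)
    · obtain ⟨r, rfl⟩ := h1
      have h3 := hτu r
      rw [if_neg, if_pos (hbI r), hb]
      · omega
      · rw [hme]
        rintro (⟨_, h⟩ | ⟨s, h⟩)
        · exact h r rfl
        · exact hbt r s h
    · by_cases h2 : ∃ r, t = top M c (q.2 r)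
      · obtain ⟨r, rfl⟩ := h2
        rw [if_pos (hme.2 (Or.inr ⟨r, rfl⟩)), ht, if_pos (hbI r), hτo _ fun s => hbt r s]
      · push Not at h1 h2
        rw [ho t h1 h2, hτo t h2]
        by_cases h3 : t ∈ upperRows M c k
        · rw [if_pos (hme.2 (Or.inl ⟨h3, h1⟩)), if_pos h3]
        · rw [if_neg (by rw [hme]; rintro (⟨h, _⟩ | ⟨r, h⟩); exacts [h3 h, h2 r h]), if_neg h3]
  -- Adding and removing a strip sort by cycles of equal length, so these signs cancel.
  have hsq : ((Equiv.Perm.sign ρ : ℤˣ) : R) * ((Equiv.Perm.sign τ : ℤˣ) : R) = 1 := by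
    rw [hρs, hτs, ← Int.cast_mul, ← Units.val_mul, Int.units_mul_self]
    simp
  rw [e1, e2, alternant_comp_perm, alternant_comp_perm, alternant_add_one, alternant_comp_perm,
    alternant_exps _ (hle (by norm_num)), alternant_exps _ (hle le_rfl), hs, piNested_eq,
    muNested_eq]
  push_cast
  linear_combination ((∏ i : Fin (M + 1), z i) * vandermondeProd z (M + 1) ^ 2 * ((-1) ^ m *
        (tableauSum (M + 1) (stripNested 1 q.1 q.2 c).board z *
          tableauSum (M + 1) (stripNested (-1) q.1 q.2 c).board z))) * hsq

/-- The Plücker relation behind the theorem, with the common factors of the alternants. -/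
theorem vandermondeProd_mul_addOmega_mul_subOmega [IsDomain R] (z : ℕ → R) :
    (∏ i : Fin (M + 1), z i) * vandermondeProd z (M + 1) ^ 2 *
        (tableauSum (M + 1) (c.addOmega k).board z * tableauSum (M + 1) (c.subOmega k).board z) =
      (∏ i : Fin (M + 1), z i) * vandermondeProd z (M + 1) ^ 2 *
        ∑ m ∈ Finset.range (c.n + 1), ∑ q ∈ nestedIndices c.n k m, (-1) ^ m *
          (tableauSum (M + 1) (piNested q.1 q.2 c).board z *
            tableauSum (M + 1) (muNested q.1 q.2 c).board z) := by
  classical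
  have hM' : c.y c.n ≤ M := by omega
  -- The relation allows any `σ` that carries `J` to `I`; where `J` comes from nested indices, the
  -- product of transpositions is chosen so that the sign is known.
  have hσ : ∀ J : Finset (Fin (M + 1)), ∃ σ : Equiv.Perm (Fin (M + 1)),
      (J.card = (upperRows M c k).card → ∀ t, σ t ∈ upperRows M c k ↔ t ∈ J) ∧
      ∀ q ∈ nestedIndices c.n k (upperRows M c k \ J).card, exchanged M c k q.1 q.2 = J →
        Equiv.Perm.sign σ = (-1) ^ (upperRows M c k \ J).card ∧
        (∀ r, σ (bottom M c (q.1 r)) = top M c (q.2 r)) ∧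
        (∀ r, σ (top M c (q.2 r)) = bottom M c (q.1 r)) ∧
        ∀ t, (∀ r, t ≠ bottom M c (q.1 r)) → (∀ r, t ≠ top M c (q.2 r)) → σ t = t := by
    intro J
    by_cases h : ∃ q ∈ nestedIndices c.n k (upperRows M c k \ J).card,
        exchanged M c k q.1 q.2 = J
    · obtain ⟨q, hq, hqJ⟩ := h
      have hq' := mem_nestedIndices.1 hq
      have hbI : ∀ r, bottom M c (q.1 r) ∈ upperRows M c k := fun r =>
        bottom_mem_upperRows hc hM' hkn (hq'.1 r).1 (hq'.1 r).2
      have htI : ∀ r, top M c (q.2 r) ∉ upperRows M c k := fun r =>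
        top_notMem_upperRows hc hM' hk (hq'.2.1 r).1 (hq'.2.1 r).2
      obtain ⟨σ, h1, h2, h3, h4⟩ := Equiv.Perm.exists_exchange
        (bottom_comp_injective hc hM' hkn hq) (top_comp_injective hc hM' hk hq)
        (fun r s h => htI s (h ▸ hbI r))
      refine ⟨σ, fun _ t => ?_, fun q₁ hq₁ hqJ₁ => ?_⟩
      · have hJt : t ∈ J ↔ t ∈ exchanged M c k q.1 q.2 := by rw [hqJ]
        rw [hJt, mem_exchanged, ← mem_upperRows (M := M)]
        by_cases h5 : ∃ r, t = bottom M c (q.1 r)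
        · obtain ⟨r, rfl⟩ := h5
          rw [h2]
          refine iff_of_false (htI r) ?_
          rintro (⟨_, h⟩ | ⟨s, h⟩)
          · exact h r rfl
          · exact htI s (h ▸ hbI r)
        · by_cases h6 : ∃ r, t = top M c (q.2 r)
          · obtain ⟨r, rfl⟩ := h6
            rw [h3]
            exact iff_of_true (hbI r) (Or.inr ⟨r, rfl⟩)
          · push Not at h5 h6
            rw [h4 t h5 h6]
            exact ⟨fun h => Or.inl ⟨h, h5⟩, by rintro (⟨h, _⟩ | ⟨r, h⟩); exacts [h, absurd h (h6 r)]⟩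
      · obtain rfl := exchanged_injOn hc hM' hk hkn hq₁ hq (hqJ₁.trans hqJ.symm)
        exact ⟨h1, h2, h3, h4⟩
    · by_cases hJ : J.card = (upperRows M c k).card
      · obtain ⟨σ, hσ⟩ := Equiv.Perm.exists_mem_iff_of_card_eq hJ
        exact ⟨σ, fun _ => hσ, fun q hq hqJ => absurd ⟨q, hq, hqJ⟩ h⟩
      · exact ⟨1, fun h' => absurd h' hJ, fun q hq hqJ => absurd ⟨q, hq, hqJ⟩ h⟩
  choose σ hσ₁ hσ₂ using hσ
  have hpl := alternant_mul_alternant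
    (fun t => if t ∈ upperRows M c k then exps M c t + 1 else exps M c t)
    (fun t => if t ∈ upperRows M c k then exps M c t else exps M c t + 1) z
    (upperRows M c k) σ hσ₁
  rw [alternant_addOmega hc hM' hk hkn, alternant_subOmega hc hM' hk hkn] at hpl
  refine Eq.trans ?_ (hpl.trans ?_)
  · ring
  rw [← Finset.sum_filter_add_sum_filter_not _ (Exchangeable M c k), add_eq_left.2, Finset.mul_sum,
    ← Finset.sum_fiberwise_of_maps_to (t := Finset.range (c.n + 1))
      (g := fun J => (upperRows M c k \ J).card)]
  · refine Finset.sum_congr rfl fun m _ => ?_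
    rw [Finset.mul_sum]
    symm
    refine Finset.sum_bij (fun q _ => exchanged M c k q.1 q.2) ?_ ?_ ?_ ?_
    · intro q hq
      have h := exchangeable_exchanged hc hM' hk hkn hq
      rw [Finset.mem_filter, Finset.mem_filter, Finset.mem_powersetCard]
      exact ⟨⟨⟨Finset.subset_univ _, h.card_eq⟩, h⟩,
        card_upperRows_sdiff_exchanged hc hM' hk hkn hq⟩
    · exact fun q hq q' hq' h => exchanged_injOn hc hM' hk hkn hq hq' h
    · intro J hJ
      rw [Finset.mem_filter, Finset.mem_filter] at hJ
      obtain ⟨q, hq, h⟩ := exists_exchanged_eq hc hM' hk hkn hJ.1.2 hJ.2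
      exact ⟨q, hq, h⟩
    · intro q hq
      obtain ⟨h1, h2, h3, h4⟩ : Equiv.Perm.sign (σ (exchanged M c k q.1 q.2)) = (-1) ^ m ∧
          (∀ r, σ (exchanged M c k q.1 q.2) (bottom M c (q.1 r)) = top M c (q.2 r)) ∧
          (∀ r, σ (exchanged M c k q.1 q.2) (top M c (q.2 r)) = bottom M c (q.1 r)) ∧
          ∀ t, (∀ r, t ≠ bottom M c (q.1 r)) → (∀ r, t ≠ top M c (q.2 r)) →
            σ (exchanged M c k q.1 q.2) t = t := by
        have hm := card_upperRows_sdiff_exchanged hc hM' hk hkn hq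
        -- In `hσ₂` the length of the tuples is a cardinality; generalizing `J` allows `m` to be
        -- replaced by it.
        generalize hJ : exchanged M c k q.1 q.2 = J at hm ⊢
        subst hm
        exact hσ₂ J q hq hJ
      exact (alternant_mul_alternant_exchanged hc hM hk hkn z hq h1 h2 h3 h4).symm
  · intro J hJ
    rw [Finset.mem_filter] at hJ
    obtain ⟨q, hq, -⟩ := exists_exchanged_eq hc hM' hk hkn hJ.2 rfl
    have := le_of_mem_nestedIndices hq
    rw [Finset.mem_range]
    omega
  · refine Finset.sum_eq_zero fun J hJ => ?_
    rw [Finset.mem_filter, Finset.mem_powersetCard] at hJ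
    exact alternant_mul_alternant_eq_zero hc hM hk hkn z hJ.1.2 hJ.2 (hσ₁ J hJ.1.2)

end Alternants

end Corners

/-! ### The outside corners of a partition. -/

/-- Conjugation: a row has length at least `a` iff it meets column `a - 1`, counted from `0`. -/
theorem length_filter_rowLens (lam : YoungDiagram) {a : ℕ} (ha : 1 ≤ a) :
    (lam.rowLens.filter fun part => a ≤ part).length = lam.colLen (a - 1) := by
  have h : (Finset.range (lam.colLen 0)).filter (fun t => a ≤ lam.rowLen t) =
      Finset.range (lam.colLen (a - 1)) := by
    ext t
    rw [Finset.mem_filter, Finset.mem_range, Finset.mem_range, ← YoungDiagram.mem_iff_lt_colLen,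
      ← YoungDiagram.mem_iff_lt_colLen, YoungDiagram.mem_iff_lt_rowLen,
      YoungDiagram.mem_iff_lt_rowLen]
    omega
  rw [← Finset.card_range (lam.colLen (a - 1)), ← h, YoungDiagram.rowLens, List.filter_map,
    List.length_map]
  rfl

theorem mem_distinctParts {lam : YoungDiagram} {a : ℕ} :
    a ∈ distinctParts lam ↔ 1 ≤ a ∧ ∃ t, lam.rowLen t = a := by
  rw [distinctParts, Finset.mem_sort, List.mem_toFinset]
  constructor
  · intro h
    refine ⟨YoungDiagram.pos_of_mem_rowLens lam a h, ?_⟩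
    rw [YoungDiagram.rowLens, List.mem_map] at h
    obtain ⟨t, _, h⟩ := h
    exact ⟨t, h⟩
  · rintro ⟨h, t, rfl⟩
    rw [YoungDiagram.rowLens, List.mem_map]
    refine ⟨t, ?_, rfl⟩
    rw [List.mem_range, ← YoungDiagram.mem_iff_lt_colLen, YoungDiagram.mem_iff_lt_rowLen]
    exact h

theorem pairwise_distinctParts (lam : YoungDiagram) :
    (distinctParts lam).Pairwise (· > ·) := by
  refine ((Finset.pairwise_sort lam.rowLens.toFinset (· ≥ ·)).and
    (Finset.sort_nodup lam.rowLens.toFinset (· ≥ ·))).imp ?_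
  rintro a b ⟨h1, h2⟩
  exact lt_of_le_of_ne h1 (Ne.symm h2)

section OutsideCorners

variable {lam : YoungDiagram}

theorem exists_rowLen_eq_outsideCorners_x {p : ℕ} (hp : 1 ≤ p) (hpn : p ≤ (outsideCorners lam).n) :
    ∃ t, 1 ≤ lam.rowLen t ∧ (outsideCorners lam).x p = lam.rowLen t ∧
      (outsideCorners lam).y p = lam.colLen (lam.rowLen t - 1) := by
  simp only [outsideCorners] at hpn ⊢
  have h : p - 1 < (distinctParts lam).length := by omega
  rw [List.getD_eq_getElem _ _ h]
  obtain ⟨h1, t, ht⟩ := mem_distinctParts.1 (List.getElem_mem h)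
  exact ⟨t, by omega, by rw [ht], by rw [ht, length_filter_rowLens lam h1]⟩

theorem outsideCorners_x_last : (outsideCorners lam).x ((outsideCorners lam).n + 1) = 0 := by
  simp [outsideCorners]

theorem outsideCorners_x_lt {p : ℕ} (hp : 1 ≤ p) (hpn : p ≤ (outsideCorners lam).n) :
    (outsideCorners lam).x (p + 1) < (outsideCorners lam).x p := by
  rcases hpn.eq_or_lt with h | h
  · rw [h, outsideCorners_x_last, ← h]
    obtain ⟨t, h1, h2, _⟩ := exists_rowLen_eq_outsideCorners_x hp hpn
    omega
  · simp only [outsideCorners] at h ⊢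
    have h1 : p - 1 < (distinctParts lam).length := by omega
    rw [Nat.add_sub_cancel, List.getD_eq_getElem _ _ h1, List.getD_eq_getElem _ _ h, Nat.cast_lt]
    exact List.pairwise_iff_getElem.1 (pairwise_distinctParts lam) _ _ h1 h (by omega)

theorem strict_outsideCorners (h : 1 ≤ (outsideCorners lam).n) : (outsideCorners lam).Strict := by
  refine ⟨outsideCorners_x_last, fun p hp hpn => outsideCorners_x_lt hp hpn, ?_, ?_⟩
  · obtain ⟨t, h1, _, h3⟩ := exists_rowLen_eq_outsideCorners_x (lam := lam) le_rfl h
    have : t < lam.colLen (lam.rowLen t - 1) := by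
      rw [← YoungDiagram.mem_iff_lt_colLen, YoungDiagram.mem_iff_lt_rowLen]
      omega
    omega
  · intro p hp hpn
    have h0 := outsideCorners_x_lt hp hpn.le
    obtain ⟨t, h1, h2, h3⟩ := exists_rowLen_eq_outsideCorners_x hp hpn.le
    obtain ⟨s, h4, h5, h6⟩ := exists_rowLen_eq_outsideCorners_x (lam := lam) (p := p + 1)
      (by omega) hpn
    have h7 : s < lam.colLen (lam.rowLen s - 1) := by
      rw [← YoungDiagram.mem_iff_lt_colLen, YoungDiagram.mem_iff_lt_rowLen]
      omega
    have h8 : ¬ s < lam.colLen (lam.rowLen t - 1) := by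
      rw [← YoungDiagram.mem_iff_lt_colLen, YoungDiagram.mem_iff_lt_rowLen]
      omega
    omega

theorem board_outsideCorners (lam : YoungDiagram) : (outsideCorners lam).board = lam := by
  refine YoungDiagram.ext (Finset.ext ?_)
  rintro ⟨a, b⟩
  rw [YoungDiagram.mem_cells, YoungDiagram.mem_cells, Corners.mem_board,
    YoungDiagram.mem_iff_lt_rowLen]
  constructor
  · rintro ⟨p, ⟨h1, h2⟩, h3, h4⟩
    obtain ⟨t, h5, h6, h7⟩ := exists_rowLen_eq_outsideCorners_x h1 h2
    rw [h7, Nat.cast_lt, ← YoungDiagram.mem_iff_lt_colLen, YoungDiagram.mem_iff_lt_rowLen] at h3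
    omega
  · intro h
    have hm : lam.rowLen a ∈ distinctParts lam := mem_distinctParts.2 ⟨by omega, a, rfl⟩
    obtain ⟨p, hp, hpa⟩ := List.getElem_of_mem hm
    have hx : (outsideCorners lam).x (p + 1) = lam.rowLen a := by
      simp only [outsideCorners, Nat.add_sub_cancel]
      rw [List.getD_eq_getElem _ _ hp, hpa]
    obtain ⟨t, h1, h2, h3⟩ := exists_rowLen_eq_outsideCorners_x (lam := lam) (p := p + 1)
      (by omega) hp
    refine ⟨p + 1, ⟨by omega, hp⟩, ?_, by omega⟩
    rw [h3, Nat.cast_lt, ← YoungDiagram.mem_iff_lt_colLen, YoungDiagram.mem_iff_lt_rowLen]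
    omega

end OutsideCorners

/-! ### Cancellation, specialization and conclusion. -/

theorem vandermondeProd_X_ne_zero (N : ℕ) :
    vandermondeProd (fun a => (MvPolynomial.X a : MvPolynomial ℕ ℤ)) N ≠ 0 := by
  induction N with
  | zero => exact one_ne_zero
  | succ N ih =>
    refine mul_ne_zero ih (Finset.prod_ne_zero_iff.2 fun i _ => sub_ne_zero.2 fun h => ?_)
    exact i.2.ne (MvPolynomial.X_injective h)

theorem nestedIndices_zero (n k : ℕ) : nestedIndices n k 0 = {default} := by
  ext q
  rw [mem_nestedIndices, Finset.mem_singleton]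
  exact iff_of_true ⟨fun r => r.elim0, fun r => r.elim0, fun r => r.elim0, fun r => r.elim0⟩
    (Subsingleton.elim _ _)

namespace Corners

theorem Strict.addOmega_mul_subOmega {c : Corners} (hc : c.Strict) {k : ℕ} (hk : 1 ≤ k)
    (hkn : k ≤ c.n) (N : ℕ) :
    schur N (c.addOmega k).board * schur N (c.subOmega k).board =
      ∑ m ∈ Finset.range (c.n + 1), ∑ q ∈ nestedIndices c.n k m, (-1) ^ m *
        (schur N (piNested q.1 q.2 c).board * schur N (muNested q.1 q.2 c).board) := by
  -- Enough variables for every board that occurs, since nested strips add at most `c.n` rows, and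
  -- at least `N` of them; those from `N` on are sent to zero below.
  set M : ℕ := (c.y c.n).toNat + c.n + N with hM
  have h := vandermondeProd_mul_addOmega_mul_subOmega (M := M) hc (by omega) hk hkn
    (fun a => (MvPolynomial.X a : MvPolynomial ℕ ℤ))
  have h0 : (∏ i : Fin (M + 1), (MvPolynomial.X (i : ℕ) : MvPolynomial ℕ ℤ)) *
      vandermondeProd (fun a => (MvPolynomial.X a : MvPolynomial ℕ ℤ)) (M + 1) ^ 2 ≠ 0 :=
    mul_ne_zero (Finset.prod_ne_zero_iff.2 fun i _ => MvPolynomial.X_ne_zero _)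
      (pow_ne_zero _ (vandermondeProd_X_ne_zero _))
  have h1 := mul_left_cancel₀ h0 h
  set z : ℕ → MvPolynomial (Fin N) ℤ :=
    fun a => if h : a < N then MvPolynomial.X ⟨a, h⟩ else 0 with hz
  have hs : ∀ nu : YoungDiagram, MvPolynomial.aeval z
      (tableauSum (M + 1) nu fun a => (MvPolynomial.X a : MvPolynomial ℕ ℤ)) = schur N nu := by
    intro nu
    have h2 := map_tableauSum (MvPolynomial.aeval z : MvPolynomial ℕ ℤ →ₐ[ℤ] _).toRingHom (M + 1)
      nu fun a => (MvPolynomial.X a : MvPolynomial ℕ ℤ)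
    refine h2.trans ?_
    rw [schur_eq_tableauSum, ← tableauSum_eq_of_le (show N ≤ M + 1 by omega) nu z
      fun a ha => by simp [hz, not_lt.2 ha]]
    simp
  have h2 := congrArg (MvPolynomial.aeval z) h1
  simpa only [map_mul, map_sum, map_pow, map_neg, map_one, hs] using h2

end Corners

theorem theorem18 (N : ℕ) (lam : YoungDiagram) (k : ℕ) (hk : 1 ≤ k)
    (hkn : k ≤ (outsideCorners lam).n) :
    schur N lam * schur N lam =
      schur N ((outsideCorners lam).addOmega k).board *
          schur N ((outsideCorners lam).subOmega k).board +
        ∑ m ∈ Finset.Icc 1 (outsideCorners lam).n,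
          ∑ q ∈ nestedIndices (outsideCorners lam).n k m,
            (-1) ^ (m - 1) *
              (schur N (Corners.piNested q.1 q.2 (outsideCorners lam)).board *
                schur N (Corners.muNested q.1 q.2 (outsideCorners lam)).board) := by
  have h := (strict_outsideCorners (hk.trans hkn)).addOmega_mul_subOmega hk hkn N
  -- The term `m = 0` has empty tuples and equals the square of `schur N lam`.
  rw [Finset.range_eq_Ico, Finset.sum_eq_sum_Ico_succ_bot (Nat.succ_pos _), nestedIndices_zero,
    Finset.sum_singleton, Corners.piNested_eq, Corners.muNested_eq, Corners.stripNested_zero,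
    Corners.stripNested_zero, board_outsideCorners, pow_zero, one_mul, zero_add,
    Nat.succ_eq_add_one, Finset.Ico_add_one_right_eq_Icc] at h
  rw [h, add_assoc, ← Finset.sum_add_distrib, Finset.sum_eq_zero, add_zero]
  intro m hm
  rw [← Finset.sum_add_distrib]
  refine Finset.sum_eq_zero fun q _ => ?_
  obtain ⟨m', rfl⟩ := Nat.exists_eq_add_of_le' (Finset.mem_Icc.1 hm).1
  rw [Nat.add_sub_cancel, pow_succ]
  ring
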